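/- Let $\beta\in\{1,2,4\}$, $\mathbb K_\beta=\mathbb R,\mathbb C,\mathbb H$ respectively, let $0\le m<n$ be integers and $k=n-m$. Put $\gamma=1$ for $\beta=1,2$ and $\gamma=2$ for $\beta=4$; for $\beta=4$ a quaternion $(a,b,c,d)$ is realised as the complex matrix $\begin{pmatrix}a+bi&c+di\\-c+di&a-bi\end{pmatrix}$, so that $\mathrm{Gl}^{(\beta)}(n,m)=\mathbb K_\beta^{n\times k}\subset\mathbb C^{\gamma n\times\gamma k}$, regarded as a real vector space of dimension $\beta nk$; $X$ denotes the indeterminate matrix in it. Define the invariant polynomials $I_1,\dots,I_k$ on $\mathrm{Gl}^{(\beta)}(n,m)$ by $$1+\sum_{j=1}^{k}\mu^jI_j(B)=\begin{cases}\det(1+\mu B^\dagger B),&\beta=1,2,\\ \mathrm{Pf}(J+\mu JB^\dagger B),&\beta=4,\end{cases}$$ where $J$ is the block diagonal $2k\times 2k$ matrix with blocks $\begin{pmatrix}0&1\\-1&0\end{pmatrix}$. Let $\mathrm{St}^{(\beta)}(n,m)=\{A\in\mathrm{Gl}^{(\beta)}(n,m): A^\dagger A=1\}$ and let $\int_{\mathrm{St}^{(\beta)}(n,m)}$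 be integration against the probability measure on it that is invariant under left multiplication by $\mathrm O(n)$, $\mathrm U(n)$, $\mathrm{USp}(2n)$ for $\beta=1,2,4$ respectively. Let $\Psi^{(\beta)}_{n,m}\in\mathbb R[[x_1,\dots,x_k]]$ be the formal power series determined by $$\Psi^{(\beta)}_{n,m}(I_1(B),\dots,I_k(B))=\int_{\mathrm{St}^{(\beta)}(n,m)}\exp\Big[\tfrac{i}{2\gamma}\big(\mathrm{tr}\,B^\dagger A+\mathrm{tr}\,A^\dagger B\big)\Big]\,dA\qquad\text{for all }B\in\mathrm{Gl}^{(\beta)}(n,m),$$ where the left-hand side is read as a formal power series in $B$, i.e. its terms are collected by their degree of homogeneity in $B$. For $\phi\in\mathbb R[[x_1,\dots,x_k]]$ let $\phi(I_1,\dots,I_k)$ be the constant-coefficient differential operator obtained by inserting for $x_j$ the operator $I_j(i\nabla)$, in which every real coordinate $x_c$ of $\mathrm{Gl}^{(\beta)}(n,m)$ is replaced by $i\,\partial/\partial x_c$ in the polynomial $I_j$. Then $\Psi^{(\beta)}_{n,m}$ exists and is well defined, and it is the unique formal power series $\phi\in\mathbb R[[x_1,\dots,x_k]]$ with constant term $\phi(0,\dots,0)=1$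 such that $$\big(\phi(I_1,\dots,I_k)\,u^2f\big)(0)=\big(\phi(I_1,\dots,I_k)\,f\big)(0),\qquad u^2:=(X^\dagger X)_{11},$$ for every polynomial $f$ on $\mathrm{Gl}^{(\beta)}(n,m)$. It is also the unique formal power series $\phi$ for which the Pizzetti formula $\int_{\mathrm{St}^{(\beta)}(n,m)}f=\big(\phi(I_1,\dots,I_k)f\big)(0)$ holds for every polynomial $f$; thus that formula is characterised by the single condition above together with $\phi(0,\dots,0)=1$. -/

import Mathlib

/-- The three values `1`, `2`, `4` of the Dyson index. -/
inductive DysonIndex : Type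
  | one
  | two
  | four

namespace Pizzetti

/-- The value of the Dyson index: the real dimension of `ℝ`, `ℂ`, `ℍ`. -/
abbrev dim : DysonIndex → ℕ
  | .one => 1
  | .two => 2
  | .four => 4

/-- The number `γ`: scalars are realised as complex `γ × γ` matrices. -/
abbrev gam : DysonIndex → ℕ
  | .one => 1
  | .two => 1
  | .four => 2

theorem gam_pos (β : DysonIndex) : 0 < gam β := by cases β <;> simp [gam]

/-- The standard real basis of `ℝ`, `ℂ`, `ℍ`, realised as complex `γ × γ` matrices. For `β = 4` this
is `1, i τ₃, i τ₂, i τ₁`, so that `(a, b, c, d)` is realised as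
`!![a + b i, c + d i; -c + d i, a - b i]`. -/
noncomputable def basisMat : (β : DysonIndex) → Fin (dim β) → Matrix (Fin (gam β)) (Fin (gam β)) ℂ
  | .one => fun _ => 1
  | .two => ![1, !![Complex.I]]
  | .four => ![1, !![Complex.I, 0; 0, -Complex.I], !![0, 1; -1, 0],
      !![0, Complex.I; Complex.I, 0]]

/-- Labels of the real coordinates of an `n × k` matrix over `ℝ`, `ℂ`, `ℍ`. -/
abbrev Coord (β : DysonIndex) (n k : ℕ) : Type := Fin n × Fin k × Fin (dim β)

/-- Complex matrices of size `γ n × γ k`, arranged in `γ × γ` blocks. -/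
abbrev CMat (β : DysonIndex) (n k : ℕ) (R : Type) : Type :=
  Matrix (Fin n × Fin (gam β)) (Fin k × Fin (gam β)) R

/-- The matrix with the given real coordinates. The coordinates may lie in any commutative
`ℂ`-algebra: real numbers (seen in `ℂ`), or indeterminates. -/
noncomputable def ofCoords (β : DysonIndex) {n k : ℕ} {R : Type} [CommRing R] [Algebra ℂ R]
    (x : Coord β n k → R) : CMat β n k R :=
  Matrix.of fun p q => ∑ c, x (p.1, q.1, c) * algebraMap ℂ R (basisMat β c p.2 q.2)

/-- The adjoint (conjugate transpose) of `ofCoords β x`, the coordinates `x` being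
treated as real quantities. -/
noncomputable def adjOfCoords (β : DysonIndex) {n k : ℕ} {R : Type} [CommRing R] [Algebra ℂ R]
    (x : Coord β n k → R) : CMat β k n R :=
  Matrix.of fun q p => ∑ c, x (p.1, q.1, c) * algebraMap ℂ R (star (basisMat β c p.2 q.2))

/-- For real coordinates `adjOfCoords` is the conjugate transpose. -/
theorem adjOfCoords_real (β : DysonIndex) {n k : ℕ} (x : Coord β n k → ℝ) :
    adjOfCoords β (fun c => (x c : ℂ)) = (ofCoords β (fun c => (x c : ℂ))).conjTranspose := by
  ext q p
  simp [adjOfCoords, ofCoords, Matrix.conjTranspose_apply]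

/-- The Pfaffian of a `2 N × 2 N` matrix whose rows and columns are indexed by `Fin N × Fin 2`, in
the order `(0,0), (0,1), (1,0), (1,1), …`:
`Pf C = (1 / N!) ∑ ω, sign ω ∏ j, C (ω (j,0)) (ω (j,1)) / 2`. -/
noncomputable def pfaffian {N : ℕ} {R : Type} [CommRing R] [Algebra ℚ R]
    (C : Matrix (Fin N × Fin 2) (Fin N × Fin 2) R) : R :=
  ((N.factorial * 2 ^ N : ℚ)⁻¹) • ∑ ω : Equiv.Perm (Fin N × Fin 2),
    ((Equiv.Perm.sign ω : ℤ) : R) * ∏ j : Fin N, C (ω (j, 0)) (ω (j, 1))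

/-- The block diagonal matrix with all diagonal blocks equal to
`i τ₂ = !![0, 1; -1, 0]`. -/
def symplecticI (N : ℕ) (R : Type) [CommRing R] : Matrix (Fin N × Fin 2) (Fin N × Fin 2) R :=
  Matrix.of fun p q => if p.1 = q.1 then (!![0, 1; -1, 0] : Matrix (Fin 2) (Fin 2) R) p.2 q.2 else 0

/-- The generating polynomial (in `μ = Polynomial.X`) of the invariants of a dyadic matrix
`M = B† B`: `det (1 + μ M)` for `β = 1, 2` and `Pf (I + μ I M)` for `β = 4`. -/
noncomputable def invGen {k : ℕ} {R : Type} [CommRing R] [Algebra ℚ R] :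
    (β : DysonIndex) → CMat β k k R → Polynomial R
  | .one => fun M => Matrix.det (1 + Polynomial.X (R := R) • M.map Polynomial.C)
  | .two => fun M => Matrix.det (1 + Polynomial.X (R := R) • M.map Polynomial.C)
  | .four => fun (M : Matrix (Fin k × Fin 2) (Fin k × Fin 2) R) =>
      pfaffian (symplecticI k (Polynomial R) +
        Polynomial.X (R := R) • (symplecticI k (Polynomial R) * M.map Polynomial.C))

/-- Polynomials (with complex coefficients) on the real vector space of `n × k` matrices. -/
abbrev Poly (β : DysonIndex) (n k : ℕ) : Type := MvPolynomial (Coord β n k) ℂ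

/-- The dyadic matrix `X† X` of the indeterminate `n × k` matrix `X`. -/
noncomputable def genericDyadic (β : DysonIndex) (n k : ℕ) : CMat β k k (Poly β n k) :=
  adjOfCoords β (n := n) (k := k) MvPolynomial.X * ofCoords β (n := n) (k := k) MvPolynomial.X

/-- The invariant polynomials `I_1, …, I_k` on the space of `n × k` matrices; `invariantPoly β n k j` is
`I_{j+1}`, the coefficient of `μ ^ (j+1)` in the generating polynomial. -/
noncomputable def invariantPoly (β : DysonIndex) (n k : ℕ) (j : Fin k) : Poly β n k :=
  (invGen β (genericDyadic β n k)).coeff (j + 1)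

/-- The polynomial `u² = (X† X)₁₁`. -/
noncomputable def uSq (β : DysonIndex) (n k : ℕ) (hk : 0 < k) : Poly β n k :=
  genericDyadic β n k (⟨0, hk⟩, ⟨0, gam_pos β⟩) (⟨0, hk⟩, ⟨0, gam_pos β⟩)

/-! ### Differential operators with constant coefficients -/

/-- The operator `i ∂/∂x_c` on polynomials. -/
noncomputable def iPartial {σ : Type} (c : σ) : Module.End ℂ (MvPolynomial σ ℂ) :=
  Complex.I • (MvPolynomial.pderiv (R := ℂ) c).toLinearMap

theorem iPartial_comm {σ : Type} (c d : σ) :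
    iPartial c * iPartial d = iPartial d * iPartial c := by
  have h : ⁅MvPolynomial.pderiv (R := ℂ) c, MvPolynomial.pderiv (R := ℂ) d⁆ = 0 := by
    apply MvPolynomial.derivation_ext
    intro i
    classical
    simp [Derivation.commutator_apply, MvPolynomial.pderiv_X, Pi.single_apply, apply_ite]
  refine LinearMap.ext fun f => ?_
  have hf := congrArg (fun D => D f) h
  simp only [Derivation.commutator_apply, Derivation.zero_apply, sub_eq_zero] at hf
  simp [iPartial, hf]

/-- The algebra of differential operators with constant coefficients. -/
noncomputable abbrev constCoeffOps (σ : Type) : Subalgebra ℂ (Module.End ℂ (MvPolynomial σ ℂ)) :=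
  Algebra.adjoin ℂ (Set.range (iPartial (σ := σ)))

instance (σ : Type) : IsMulCommutative (constCoeffOps σ) :=
  Algebra.isMulCommutative_adjoin ℂ (by
    rintro _ ⟨c, rfl⟩ _ ⟨d, rfl⟩
    exact iPartial_comm c d)

open scoped IsMulCommutative in
/-- `P ↦ P(i∇)`: the algebra homomorphism which substitutes `i ∂/∂x_c` for every real coordinate
`x_c` in a polynomial `P`. -/
noncomputable def evalIGrad {σ : Type} :
    MvPolynomial σ ℂ →ₐ[ℂ] Module.End ℂ (MvPolynomial σ ℂ) :=
  (constCoeffOps σ).val.comp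
    (MvPolynomial.aeval fun c : σ =>
      (⟨iPartial c, Algebra.subset_adjoin ⟨c, rfl⟩⟩ : constCoeffOps σ))

/-- `(φ(I_1, …, I_k) f)(0)` with `I_j = I_j(i∇)`, for a formal power series `φ` and a polynomial
`f`. Only finitely many terms are nonzero, since `I_j(i∇)` lowers the degree by `2 j`. -/
noncomputable def applySeries (β : DysonIndex) (n k : ℕ) (φ : MvPowerSeries (Fin k) ℝ)
    (f : Poly β n k) : ℂ :=
  ∑ᶠ a : Fin k →₀ ℕ, ((MvPowerSeries.coeff a φ : ℝ) : ℂ) *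
    MvPolynomial.eval 0 (evalIGrad (∏ j, invariantPoly β n k j ^ a j) f)

/-! ### The Stiefel manifold and its invariant integral -/

/-- The space `Gl^{(β)}` of rectangular matrices over `ℝ`, `ℂ`, `ℍ`, inside the complex
`γ n × γ k` matrices: `A* = A` for `β = 1`, and `A* = τ₂ A τ₂` for `β = 4`
(where `τ₂ A τ₂ = - (i τ₂) A (i τ₂)`). -/
def InGl {n k : ℕ} : (β : DysonIndex) → CMat β n k ℂ → Prop
  | .one => fun A => A.map star = A
  | .two => fun _ => True
  | .four => fun (A : Matrix (Fin n × Fin 2) (Fin k × Fin 2) ℂ) =>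
      A.map star = -(symplecticI n ℂ * A * symplecticI k ℂ)

/-- The real coordinates of a matrix in `Gl^{(β)}`. -/
noncomputable def coords {n k : ℕ} :
    (β : DysonIndex) → CMat β n k ℂ → Coord β n k → ℝ
  | .one => fun A c => (A (c.1, 0) (c.2.1, 0)).re
  | .two => fun A c => ![(A (c.1, 0) (c.2.1, 0)).re, (A (c.1, 0) (c.2.1, 0)).im] c.2.2
  | .four => fun A c => ![(A (c.1, 0) (c.2.1, 0)).re, (A (c.1, 0) (c.2.1, 0)).im,
      (A (c.1, 0) (c.2.1, 1)).re, (A (c.1, 0) (c.2.1, 1)).im] c.2.2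

theorem symplecticI_sq (N : ℕ) : symplecticI N ℂ * symplecticI N ℂ = -1 := by
  ext ⟨i, a⟩ ⟨j, b⟩
  rw [Matrix.mul_apply, Fintype.sum_prod_type, Finset.sum_eq_single i]
  · by_cases h : i = j
    · subst h
      fin_cases a <;> fin_cases b <;> simp [symplecticI]
    · have : ((i, a) : Fin N × Fin 2) ≠ (j, b) := fun e => h (congrArg Prod.fst e)
      simp [symplecticI, h, Matrix.one_apply_ne this]
  · intro l _ hl
    simp [symplecticI, Ne.symm hl]
  · simp

theorem InGl.one (β : DysonIndex) (n : ℕ) : InGl β (1 : CMat β n n ℂ) := by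
  cases β
  · simp [InGl]
  · trivial
  · simp only [InGl]
    rw [Matrix.mul_one, symplecticI_sq, neg_neg]
    simp

theorem InGl.mul (β : DysonIndex) {n l k : ℕ} {A : CMat β n l ℂ} {B : CMat β l k ℂ}
    (hA : InGl β A) (hB : InGl β B) : InGl β (A * B) := by
  have hmap : (A * B).map star = A.map star * B.map star := by
    exact Matrix.map_mul (L := A) (M := B) (f := starRingEnd ℂ)
  cases β
  · simp only [InGl] at *
    rw [hmap, hA, hB]
  · trivial
  · simp only [InGl] at *
    rw [hmap, hA, hB]
    have e := symplecticI_sq l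
    have h : ∀ (A : Matrix (Fin n × Fin 2) (Fin l × Fin 2) ℂ)
        (B : Matrix (Fin l × Fin 2) (Fin k × Fin 2) ℂ),
        -(symplecticI n ℂ * A * symplecticI l ℂ) * -(symplecticI l ℂ * B * symplecticI k ℂ) =
          -(symplecticI n ℂ * (A * B) * symplecticI k ℂ) := by
      intro A B
      rw [Matrix.neg_mul, Matrix.mul_neg, neg_neg]
      calc symplecticI n ℂ * A * symplecticI l ℂ * (symplecticI l ℂ * B * symplecticI k ℂ)
          = symplecticI n ℂ * A * (symplecticI l ℂ * symplecticI l ℂ) * (B * symplecticI k ℂ) := by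
            simp only [Matrix.mul_assoc]
        _ = _ := by
            rw [e]
            simp only [Matrix.mul_assoc, Matrix.mul_neg, Matrix.neg_mul, Matrix.mul_one]
    exact h A B

theorem symplecticI_conjTranspose (N : ℕ) :
    (symplecticI N ℂ).conjTranspose = -symplecticI N ℂ := by
  ext ⟨i, a⟩ ⟨j, b⟩
  by_cases h : i = j
  · subst h
    fin_cases a <;> fin_cases b <;> simp [symplecticI]
  · simp [symplecticI, h, Ne.symm h]

theorem InGl.conjTranspose (β : DysonIndex) {n k : ℕ} {A : CMat β n k ℂ}
    (hA : InGl β A) : InGl β A.conjTranspose := by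
  have hmap : A.conjTranspose.map star = (A.map star).conjTranspose := rfl
  cases β
  · simp only [InGl] at *
    rw [hmap, hA]
  · trivial
  · simp only [InGl] at *
    rw [hmap, hA]
    simp only [Matrix.conjTranspose_neg, Matrix.conjTranspose_mul, symplecticI_conjTranspose,
      Matrix.neg_mul, Matrix.mul_neg, neg_neg, Matrix.mul_assoc]

theorem InGl.isClosed (β : DysonIndex) (n k : ℕ) : IsClosed {A : CMat β n k ℂ | InGl β A} := by
  cases β
  · exact isClosed_eq (f := fun A : CMat .one n k ℂ => A.map star)
      (continuous_id.matrix_map continuous_star) continuous_id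
  · exact isClosed_univ
  · exact isClosed_eq (f := fun A : Matrix (Fin n × Fin 2) (Fin k × Fin 2) ℂ => A.map star)
      (continuous_id.matrix_map continuous_star)
      ((continuous_const.matrix_mul continuous_id).matrix_mul continuous_const).neg

/-- The compact group acting on the left: the orthogonal group `O(n)` for `β = 1`, the unitary group
`U(n)` for `β = 2`, and the unitary symplectic group `USp(2n)` for `β = 4`. -/
def unitaryGp (β : DysonIndex) (n : ℕ) :
    Subgroup (Matrix.unitaryGroup (Fin n × Fin (gam β)) ℂ) where
  carrier := {U | InGl β (n := n) (k := n) U.1}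
  mul_mem' := fun hA hB => InGl.mul β hA hB
  one_mem' := InGl.one β n
  inv_mem' := fun hA => InGl.conjTranspose β hA

instance (β : DysonIndex) (n : ℕ) : CompactSpace (unitaryGp β n) := by
  have hU : IsCompact (Matrix.unitaryGroup (Fin n × Fin (gam β)) ℂ :
      Set (Matrix (Fin n × Fin (gam β)) (Fin n × Fin (gam β)) ℂ)) := by
    have hb : IsCompact (Set.pi Set.univ fun _ => Set.pi Set.univ fun _ =>
        Metric.closedBall (0 : ℂ) 1 : Set (Matrix (Fin n × Fin (gam β)) (Fin n × Fin (gam β)) ℂ)) :=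
      isCompact_univ_pi fun _ => isCompact_univ_pi fun _ => isCompact_closedBall _ _
    have hcl : IsClosed (Matrix.unitaryGroup (Fin n × Fin (gam β)) ℂ :
      Set (Matrix (Fin n × Fin (gam β)) (Fin n × Fin (gam β)) ℂ)) := isClosed_unitary
    refine hb.of_isClosed_subset hcl fun U hU => ?_
    intro p _ q _
    simpa using entry_norm_bound_of_unitary hU p q
  have : CompactSpace (Matrix.unitaryGroup (Fin n × Fin (gam β)) ℂ) :=
    isCompact_iff_compactSpace.mp hU
  have hc : IsClosed (unitaryGp β n : Set (Matrix.unitaryGroup (Fin n × Fin (gam β)) ℂ)) :=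
    (InGl.isClosed β n n).preimage continuous_subtype_val
  exact isCompact_iff_compactSpace.mp hc.isCompact

noncomputable instance (β : DysonIndex) (n : ℕ) : MeasurableSpace (unitaryGp β n) := borel _

instance (β : DysonIndex) (n : ℕ) : BorelSpace (unitaryGp β n) := ⟨rfl⟩

/-- The Haar measure of total mass one on the compact group. -/
noncomputable def haar (β : DysonIndex) (n : ℕ) : MeasureTheory.Measure (unitaryGp β n) :=
  MeasureTheory.Measure.haarMeasure ⊤

/-- The first `k` columns (over `ℝ`, `ℂ`, `ℍ`) of a group element: a point of the Stiefel manifold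
`{A | A† A = 1}`. -/
def firstCols (β : DysonIndex) {n k : ℕ} (hk : k ≤ n) (U : unitaryGp β n) : CMat β n k ℂ :=
  U.1.1.submatrix id (Prod.map (Fin.castLE hk) id)

/-- The normalised integral of `F` over the Stiefel manifold of `n × k` matrices `A` with
`A† A = 1`, with respect to its left invariant probability measure (the image of the Haar
measure of the group under the quotient map). -/
noncomputable def stiefelIntegral (β : DysonIndex) {n k : ℕ} (hk : k ≤ n)
    (F : CMat β n k ℂ → ℂ) : ℂ :=
  ∫ U, F (firstCols β hk U) ∂(haar β n)

/-- `Ψ̂(B) = ∫ exp (i (tr B† A + tr A† B) / (2 γ))`, integrated over `A` in the Stiefel manifold. -/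
noncomputable def psiHat (β : DysonIndex) {n k : ℕ} (hk : k ≤ n) (B : CMat β n k ℂ) : ℂ :=
  stiefelIntegral β hk fun A => Complex.exp
    (Complex.I * ((B.conjTranspose * A).trace + (A.conjTranspose * B).trace) / (2 * gam β))

/-- The multi-indices `a` for which the monomial `I_1 ^ a_1 ⋯ I_k ^ a_k` is homogeneous of degree
`2 d` in the coordinates, i.e. `∑ j * a_j = d`. -/
noncomputable def multiIndices (k d : ℕ) : Finset (Fin k →₀ ℕ) :=
  (Finsupp.finite_of_nat_weight_le (fun j : Fin k => (j : ℕ) + 1)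
    (fun _ => Nat.succ_ne_zero _) d).toFinset.filter fun a => ∑ j : Fin k, ((j : ℕ) + 1) * a j = d

theorem mem_multiIndices {k d : ℕ} {a : Fin k →₀ ℕ} :
    a ∈ multiIndices k d ↔ ∑ j : Fin k, ((j : ℕ) + 1) * a j = d := by
  simp only [multiIndices, Finset.mem_filter, Set.Finite.mem_toFinset, Set.mem_ofPred_eq,
    Finsupp.weight_apply, and_iff_right_iff_imp]
  intro h
  rw [← h, Finsupp.sum_fintype _ _ (by simp)]
  exact le_of_eq (Finset.sum_congr rfl fun j _ => by simp [mul_comm])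

/-- `ψ(I_1(B), …, I_k(B)) = Ψ̂(B)` as a formal power series in `B`, for every `B` in `Gl^{(β)}`:
the terms of `ψ(I_1, …, I_k)` which are homogeneous of degree `2 d` in `B` are collected, and the
resulting series in `d` converges to `Ψ̂(B)`. -/
def IsPizzettiSeries (β : DysonIndex) {n k : ℕ} (hk : k ≤ n) (ψ : MvPowerSeries (Fin k) ℝ) : Prop :=
  ∀ B : CMat β n k ℂ, InGl β B → HasSum (fun d : ℕ => ∑ a ∈ multiIndices k d,
    ((MvPowerSeries.coeff a ψ : ℝ) : ℂ) * ∏ j, MvPolynomial.eval (fun c => (coords β B c : ℂ))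
      (invariantPoly β n k j) ^ a j) (psiHat β hk B)

end Pizzetti

/-! Everything is read through the bilinear pairing `fischer P f` = (P(i∇)f)(0). Monomials are
orthogonal for it, with weight i^|b| b!, so it is symmetric. In each degree m it is nondegenerate,
and pairing P with its complex conjugate gives i^m times a positive definite quantity. Applied to f
homogeneous of degree 2d, a series φ(I₁,…,I_k) acts only through its part `component` of degree 2d.
On odd degrees it gives 0.

Existence. The exponent of the integrand is i times the Euclidean scalar product ⟨B, A⟩, and
averaging over A ↦ -A leaves cos⟨B, A⟩. Its degree 2d term, integrated over A, is `momentPoly`. The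
coefficients of `momentPoly` are moments divided by exactly the Fischer weights, so pairing with it
integrates f (`fischer_momentPoly`). These polynomials are invariant under the groups acting on both
sides. By the singular value decomposition (`exists_svd`) they are determined by their values on
rectangular diagonal matrices, where they are even and symmetric in the singular values. They are
therefore polynomials in the elementary symmetric functions of the s_j², which are the I_j.
Assembling them over d gives Ψ (`exists_component_eq`).

Uniqueness from the Pizzetti formula is nondegeneracy of the pairing; uniqueness from the integral
follows by scaling B. In both cases the components determine the series, since elementary symmetric
polynomials are algebraically independent (`eq_of_component_eq`).

Uniqueness from the u² condition is an induction on d. If two solutions agree in degree 2d, their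
difference E in degree 2(d+1) pairs to zero with u²f for every f. Since E is invariant under the
right group, rotating and polarising replaces u² by any entry of X†X, so E is orthogonal to the
ideal these entries generate. This ideal contains E, because the I_j have no constant term, and it
is stable under conjugation. So E pairs to zero with its own conjugate and vanishes
(`eq_zero_of_fischer_uSq`). Ψ satisfies the condition because u² = 1 on the Stiefel manifold. -/

namespace Pizzetti

/-! ### The Fischer pairing -/

section Fischer

variable {σ : Type}

open MvPolynomial

theorem evalIGrad_X (c : σ) : evalIGrad (X c) = iPartial c := by
  simp [evalIGrad]

/-- The bilinear pairing `(P, f) ↦ (P(i∇) f)(0)`. -/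
noncomputable def fischer : MvPolynomial σ ℂ →ₗ[ℂ] MvPolynomial σ ℂ →ₗ[ℂ] ℂ :=
  LinearMap.mk₂ ℂ (fun P f => eval 0 (evalIGrad P f)) (by simp) (by simp)
    (by simp) (by simp)

theorem fischer_apply (P f : MvPolynomial σ ℂ) : fischer P f = eval 0 (evalIGrad P f) := rfl

theorem fischer_mul (P Q f : MvPolynomial σ ℂ) : fischer (P * Q) f = fischer P (evalIGrad Q f) := by
  simp [fischer_apply]

/-- Real points suffice because ℝ is an infinite subset of ℂ in every coordinate. -/
theorem ext_real {P Q : MvPolynomial σ ℂ}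
    (h : ∀ x : σ → ℝ, eval (fun c => (x c : ℂ)) P = eval (fun c => (x c : ℂ)) Q) : P = Q := by
  refine funext_set (fun _ => Set.range ((↑) : ℝ → ℂ))
    (fun _ => Set.infinite_range_of_injective Complex.ofReal_injective) fun x hx => ?_
  choose y hy using fun c => hx c (Set.mem_univ c)
  have : x = fun c => (y c : ℂ) := funext fun c => (hy c).symm
  rw [this]
  exact h y

variable [Fintype σ]

/-- The norm `i ^ |b| b!` of the monomial `X ^ b` for the Fischer pairing. -/
noncomputable def fischerWeight (b : σ →₀ ℕ) : ℂ := ∏ c, (Complex.I ^ b c * (b c).factorial)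

theorem fischerWeight_eq (b : σ →₀ ℕ) :
    fischerWeight b = Complex.I ^ b.degree * ∏ c, ((b c).factorial : ℂ) := by
  rw [fischerWeight, Finset.prod_mul_distrib, Finset.prod_pow_eq_pow_sum, Finsupp.degree_eq_sum]

theorem fischerWeight_add_single (b : σ →₀ ℕ) (c : σ) :
    fischerWeight (b + Finsupp.single c 1) = Complex.I * (b c + 1) * fischerWeight b := by
  classical
  rw [fischerWeight, fischerWeight, ← Finset.mul_prod_erase _ _ (Finset.mem_univ c),
    ← Finset.mul_prod_erase Finset.univ (fun c => Complex.I ^ b c * ((b c).factorial : ℂ))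
      (Finset.mem_univ c)]
  have : ∀ d ∈ Finset.univ.erase c,
      Complex.I ^ ((b + Finsupp.single c 1 : σ →₀ ℕ) d) *
        (((b + Finsupp.single c 1 : σ →₀ ℕ) d).factorial : ℂ) =
        Complex.I ^ b d * ((b d).factorial : ℂ) := by
    intro d hd
    have : d ≠ c := Finset.ne_of_mem_erase hd
    simp [this.symm]
  rw [Finset.prod_congr rfl this]
  simp only [Finsupp.add_apply, Finsupp.single_eq_same, Nat.factorial_succ, pow_succ]
  push_cast
  ring

/-- Orthogonality of monomials: each factor `X c` of P lowers one exponent of the monomial and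
contributes a factor i·(exponent), and evaluation at 0 keeps only an exact match. -/
theorem fischer_monomial_right (P : MvPolynomial σ ℂ) (b : σ →₀ ℕ) (v : ℂ) :
    fischer P (monomial b v) = v * coeff b P * fischerWeight b := by
  classical
  induction P using MvPolynomial.induction_on generalizing b v with
  | C r =>
    by_cases hb : b = 0
    · subst hb
      simp [fischer_apply, fischerWeight, ← algebraMap_eq, mul_comm]
    · have h1 : eval (0 : σ → ℂ) (monomial b v) = 0 := by
        rw [eval_zero, constantCoeff_monomial, if_neg hb]
      rw [fischer_apply, ← algebraMap_eq, AlgHom.commutes, Module.algebraMap_end_apply, smul_eval, h1,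
        algebraMap_eq, coeff_C, if_neg (Ne.symm hb)]
      simp
  | add P Q hP hQ => simp [hP, hQ]; ring
  | mul_X P c hP =>
    rw [fischer_mul, evalIGrad_X, iPartial, LinearMap.smul_apply, map_smul]
    simp only [Derivation.coeFn_coe, pderiv_monomial, hP, coeff_mul_X', smul_eq_mul]
    by_cases hc : b c = 0
    · simp [hc]
    · obtain ⟨b, rfl⟩ : ∃ b', b = b' + Finsupp.single c 1 :=
        ⟨b - Finsupp.single c 1, by
          rw [tsub_add_cancel_of_le]
          simpa [Finsupp.single_le_iff, Nat.one_le_iff_ne_zero] using hc⟩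
      rw [if_pos (by simp), add_tsub_cancel_right, fischerWeight_add_single]
      simp only [Finsupp.add_apply, Finsupp.single_eq_same]
      push_cast
      ring

theorem fischer_eq_sum (P f : MvPolynomial σ ℂ) :
    fischer P f = ∑ b ∈ f.support, coeff b f * coeff b P * fischerWeight b := by
  conv_lhs => rw [f.as_sum]
  rw [map_sum]
  exact Finset.sum_congr rfl fun b _ => fischer_monomial_right _ _ _

theorem fischer_comm (P f : MvPolynomial σ ℂ) : fischer P f = fischer f P := by
  classical
  rw [fischer_eq_sum, fischer_eq_sum, ← Finset.sum_subset Finset.inter_subset_left,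
    ← Finset.sum_subset (s₁ := f.support ∩ P.support) Finset.inter_subset_right]
  · exact Finset.sum_congr rfl fun b _ => by ring
  · intro b hb hb'
    have : coeff b f = 0 := by
      by_contra h
      exact hb' (Finset.mem_inter.2 ⟨mem_support_iff.2 h, hb⟩)
    simp [this]
  · intro b hb hb'
    have : coeff b P = 0 := by
      by_contra h
      exact hb' (Finset.mem_inter.2 ⟨hb, mem_support_iff.2 h⟩)
    simp [this]

theorem fischerWeight_ne_zero (b : σ →₀ ℕ) : fischerWeight b ≠ 0 :=
  Finset.prod_ne_zero_iff.2 fun _ _ =>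
    mul_ne_zero (pow_ne_zero _ Complex.I_ne_zero) (Nat.cast_ne_zero.2 (Nat.factorial_ne_zero _))

theorem fischer_of_isHomogeneous {P f : MvPolynomial σ ℂ} {l m : ℕ} (hP : P.IsHomogeneous l)
    (hf : f.IsHomogeneous m) (h : l ≠ m) : fischer P f = 0 := by
  rw [fischer_eq_sum]
  refine Finset.sum_eq_zero fun b hb => ?_
  have hb' : b.degree = m := by
    by_contra hne
    exact mem_support_iff.1 hb (hf.coeff_eq_zero hne)
  rw [hP.coeff_eq_zero (by rw [hb']; exact h.symm)]
  simp

theorem eq_zero_of_fischer_homogeneous {P : MvPolynomial σ ℂ} {m : ℕ} (hP : P.IsHomogeneous m)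
    (h : ∀ f : MvPolynomial σ ℂ, f.IsHomogeneous m → fischer P f = 0) : P = 0 := by
  ext b
  by_cases hb : b.degree = m
  · have := h (monomial b 1) (isHomogeneous_monomial _ hb)
    rw [fischer_monomial_right] at this
    simpa [fischerWeight_ne_zero] using this
  · simp [hP.coeff_eq_zero hb]

/-- All weights of one degree share the phase i^m, so the pairing is i^m ∑ |P_b|² b!, a sum of
nonnegative terms up to a unit. -/
theorem eq_zero_of_fischer_conj {P : MvPolynomial σ ℂ} {m : ℕ} (hP : P.IsHomogeneous m)
    (h : fischer P (map (starRingEnd ℂ) P) = 0) : P = 0 := by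
  rw [fischer_comm, fischer_eq_sum] at h
  have e : ∀ b ∈ P.support, coeff b P * coeff b (map (starRingEnd ℂ) P) * fischerWeight b =
      Complex.I ^ m * ((Complex.normSq (coeff b P) * ∏ c, ((b c).factorial : ℝ) : ℝ) : ℂ) := by
    intro b hb
    have hb' : b.degree = m := by
      by_contra hne
      exact mem_support_iff.1 hb (hP.coeff_eq_zero hne)
    rw [fischerWeight_eq, hb', coeff_map, Complex.mul_conj]
    push_cast
    ring
  rw [Finset.sum_congr rfl e, ← Finset.mul_sum, mul_eq_zero] at h
  have h' := h.resolve_left (pow_ne_zero _ Complex.I_ne_zero)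
  rw [← Complex.ofReal_sum, Complex.ofReal_eq_zero, Finset.sum_eq_zero_iff_of_nonneg
    (fun b _ => mul_nonneg (Complex.normSq_nonneg _) (by positivity))] at h'
  ext b
  by_contra hb
  have := h' b (mem_support_iff.2 hb)
  rw [mul_eq_zero, Complex.normSq_eq_zero] at this
  rcases this with h0 | h0
  · exact hb (by simpa using h0)
  · exact absurd h0 (Finset.prod_ne_zero_iff.2 fun c _ =>
      Nat.cast_ne_zero.2 (Nat.factorial_ne_zero _))

/-- The linear substitution `X ↦ T X` in polynomials. -/
noncomputable def linSubst (T : Matrix σ σ ℝ) : MvPolynomial σ ℂ →ₐ[ℂ] MvPolynomial σ ℂ :=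
  aeval fun c => ∑ d, C (T c d : ℂ) * X d

theorem eval_linSubst (T : Matrix σ σ ℝ) (x : σ → ℂ) (f : MvPolynomial σ ℂ) :
    eval x (linSubst T f) = eval (fun c => ∑ d, (T c d : ℂ) * x d) f := by
  induction f using MvPolynomial.induction_on with
  | C r => simp [linSubst]
  | add P Q hP hQ => simp [hP, hQ]
  | mul_X P c hP => simp [hP]; left; simp [linSubst]

theorem pderiv_linSubst [DecidableEq σ] (T : Matrix σ σ ℝ) (d : σ) (f : MvPolynomial σ ℂ) :
    pderiv d (linSubst T f) = ∑ c, C (T c d : ℂ) * linSubst T (pderiv c f) := by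
  induction f using MvPolynomial.induction_on with
  | C r => simp [linSubst]
  | add P Q hP hQ => simp [hP, hQ, mul_add, Finset.sum_add_distrib]
  | mul_X P e hP =>
    rw [map_mul, pderiv_mul, hP]
    have h1 : pderiv d (linSubst T (X e)) = C (T e d : ℂ) := by
      simp [linSubst, pderiv_X, Pi.single_apply]
    rw [h1]
    simp only [pderiv_mul, map_add, map_mul, mul_add, Finset.sum_add_distrib, pderiv_X]
    congr 1
    · rw [Finset.sum_mul]
      exact Finset.sum_congr rfl fun c _ => by ring
    · rw [Finset.sum_eq_single e]
      · simp; ring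
      · intro c _ hc
        simp [Ne.symm hc]
      · simp

/-- Chain rule: differentiating f∘T brings out Tᵀ, substituting T in P brings out T, and T Tᵀ = 1
cancels them. -/
theorem evalIGrad_linSubst [DecidableEq σ] {T : Matrix σ σ ℝ} (hT : T * T.transpose = 1)
    (P f : MvPolynomial σ ℂ) :
    evalIGrad (linSubst T P) (linSubst T f) = linSubst T (evalIGrad P f) := by
  induction P using MvPolynomial.induction_on generalizing f with
  | C r => simp [← algebraMap_eq]
  | add P Q hP hQ => simp [hP, hQ]
  | mul_X P e hP =>
    have h : evalIGrad (linSubst T (X e)) (linSubst T f) = linSubst T (iPartial e f) := by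
      have h1 : evalIGrad (linSubst T (X e)) = ∑ d, (T e d : ℂ) • iPartial d := by
        simp only [linSubst, aeval_X, C_mul', map_sum, map_smul, evalIGrad_X]
      rw [h1]
      simp only [LinearMap.sum_apply, LinearMap.smul_apply, iPartial, Derivation.coeFn_coe,
        pderiv_linSubst, map_smul]
      simp_rw [smul_comm _ Complex.I, ← Finset.smul_sum]
      congr 1
      simp_rw [Finset.smul_sum, C_mul', smul_smul]
      rw [Finset.sum_comm]
      simp_rw [← Finset.sum_smul]
      have h2 : ∀ c, ∑ d, ((T e d : ℂ) * (T c d : ℂ)) = if e = c then 1 else 0 := by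
        intro c
        have := congrFun (congrFun hT e) c
        rw [Matrix.mul_apply, Matrix.one_apply] at this
        simp only [Matrix.transpose_apply] at this
        have := congrArg ((↑) : ℝ → ℂ) this
        push_cast at this
        rw [this]
        split_ifs <;> simp
      simp [h2]
    rw [map_mul, map_mul, Module.End.mul_apply, h, hP, map_mul, Module.End.mul_apply, evalIGrad_X]

theorem fischer_linSubst [DecidableEq σ] {T : Matrix σ σ ℝ} (hT : T * T.transpose = 1)
    (P f : MvPolynomial σ ℂ) :
    fischer (linSubst T P) (linSubst T f) = fischer P f := by
  rw [fischer_apply, evalIGrad_linSubst hT, eval_linSubst, fischer_apply]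
  congr 2
  simp
  rfl

/-- One scaling factor is enough, since the powers 2^|b| distinguish degrees. -/
theorem isHomogeneous_of_eval_two {P : MvPolynomial σ ℂ} {m : ℕ}
    (h : ∀ x : σ → ℝ, eval (fun c => ((2 * x c : ℝ) : ℂ)) P =
      2 ^ m * eval (fun c => (x c : ℂ)) P) : P.IsHomogeneous m := by
  classical
  have h1 : linSubst ((2 : ℝ) • (1 : Matrix σ σ ℝ)) P = C (2 ^ m) * P := by
    refine ext_real fun x => ?_
    rw [eval_linSubst, map_mul, eval_C, ← h x]
    congr 2
    simp [Matrix.one_apply, apply_ite]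
  have h2 : linSubst ((2 : ℝ) • (1 : Matrix σ σ ℝ)) P =
      ∑ b ∈ P.support, monomial b (2 ^ b.degree * coeff b P) := by
    refine ext_real fun x => ?_
    rw [eval_linSubst]
    conv_lhs => rw [eval_eq']
    rw [map_sum]
    refine Finset.sum_congr rfl fun b _ => ?_
    simp only [eval_monomial, Matrix.smul_apply, Matrix.one_apply, smul_eq_mul, mul_ite, mul_one,
      mul_zero, Finsupp.degree_eq_sum]
    rw [Finsupp.prod_fintype _ _ (by simp), ← Finset.prod_pow_eq_pow_sum]
    rw [mul_assoc, mul_left_comm, ← Finset.prod_mul_distrib]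
    congr 1
    refine Finset.prod_congr rfl fun c _ => ?_
    rw [← mul_pow]
    congr 1
    simp [apply_ite]
  intro b hb
  have h3 := congrArg (coeff b) (h1.symm.trans h2)
  rw [coeff_C_mul, coeff_sum, Finset.sum_eq_single b] at h3
  · rw [coeff_monomial, if_pos rfl] at h3
    have h4 : (2 : ℂ) ^ m = 2 ^ b.degree := mul_right_cancel₀ hb h3
    have h5 : (2 : ℕ) ^ m = 2 ^ b.degree := by exact_mod_cast h4
    have h6 := Nat.pow_right_injective le_rfl h5
    rw [h6]
    simp [Finsupp.weight_apply, Finsupp.degree_eq_sum, Finsupp.sum_fintype]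
  · intro b' _ hb'
    rw [coeff_monomial, if_neg hb']
  · intro hb'
    simp [notMem_support_iff.1 hb']

end Fischer


/-! ### The Pfaffian -/

section Pfaffian

variable {N : ℕ} {R : Type} [CommRing R]

/-- As for multiplicativity of the determinant: expanding the entries gives a sum over all maps f of
the index set, and the sum over ω turns into the determinant of h with rows selected by f. A
repeated row gives 0; otherwise f is a permutation and contributes sign f · det h. -/
theorem sum_sign_prod_eq_det_mul (C h : Matrix (Fin N × Fin 2) (Fin N × Fin 2) R) :
    (∑ ω : Equiv.Perm (Fin N × Fin 2), ((Equiv.Perm.sign ω : ℤ) : R) *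
        ∏ j, (h.transpose * C * h) (ω (j, 0)) (ω (j, 1))) =
      h.det * ∑ ω : Equiv.Perm (Fin N × Fin 2), ((Equiv.Perm.sign ω : ℤ) : R) *
        ∏ j, C (ω (j, 0)) (ω (j, 1)) := by
  have h1 : ∀ a b, (h.transpose * C * h) a b =
      ∑ v : Fin 2 → Fin N × Fin 2, h (v 0) a * h (v 1) b * C (v 0) (v 1) := by
    intro a b
    rw [← (finTwoArrowEquiv (Fin N × Fin 2)).symm.sum_comp, Fintype.sum_prod_type, Finset.sum_comm]
    simp only [Matrix.mul_apply, Matrix.transpose_apply, Finset.sum_mul]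
    refine Finset.sum_congr rfl fun q _ => Finset.sum_congr rfl fun p _ => ?_
    simp
    ring
  have h2 : ∀ ω : Equiv.Perm (Fin N × Fin 2),
      ∏ j, (h.transpose * C * h) (ω (j, 0)) (ω (j, 1)) =
        ∑ f : Fin N × Fin 2 → Fin N × Fin 2, (∏ j, C (f (j, 0)) (f (j, 1))) *
          ∏ x, h (f x) (ω x) := by
    intro ω
    simp_rw [h1]
    rw [Finset.prod_univ_sum, Fintype.piFinset_univ,
      ← (Equiv.curry (Fin N) (Fin 2) (Fin N × Fin 2)).sum_comp]
    refine Finset.sum_congr rfl fun f _ => ?_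
    rw [Fintype.prod_prod_type, ← Finset.prod_mul_distrib]
    refine Finset.prod_congr rfl fun j _ => ?_
    simp [Function.curry]
    ring
  have h3 : ∀ f : Fin N × Fin 2 → Fin N × Fin 2,
      ∑ ω : Equiv.Perm (Fin N × Fin 2), ((Equiv.Perm.sign ω : ℤ) : R) * ∏ x, h (f x) (ω x) =
        (h.submatrix f id).det := by
    intro f
    rw [← Matrix.det_transpose, Matrix.det_apply']
    rfl
  simp_rw [h2, Finset.mul_sum]
  rw [Finset.sum_comm]
  have h4 : ∀ f : Fin N × Fin 2 → Fin N × Fin 2,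
      ∑ ω : Equiv.Perm (Fin N × Fin 2), ((Equiv.Perm.sign ω : ℤ) : R) *
        ((∏ j, C (f (j, 0)) (f (j, 1))) * ∏ x, h (f x) (ω x)) =
      (∏ j, C (f (j, 0)) (f (j, 1))) * (h.submatrix f id).det := by
    intro f
    rw [← h3, Finset.mul_sum]
    exact Finset.sum_congr rfl fun ω _ => by ring
  simp_rw [h4]
  symm
  refine Fintype.sum_of_injective (fun ω : Equiv.Perm (Fin N × Fin 2) => (ω : _ → _))
    DFunLike.coe_injective _ _ ?_ ?_
  · intro f hf
    have hf' : ¬ Function.Injective f := fun hi =>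
      hf ⟨Equiv.ofBijective f (Finite.injective_iff_bijective.1 hi), rfl⟩
    simp only [Function.Injective, not_forall] at hf'
    obtain ⟨a, b, hab, hne⟩ := hf'
    rw [Matrix.det_zero_of_row_eq hne (by ext; simp [hab]), mul_zero]
  · intro ω
    rw [Matrix.det_permute]
    ring

theorem pfaffian_conj [Algebra ℚ R] (C h : Matrix (Fin N × Fin 2) (Fin N × Fin 2) R) :
    pfaffian (h.transpose * C * h) = h.det * pfaffian C := by
  rw [pfaffian, pfaffian, sum_sign_prod_eq_det_mul, mul_smul_comm]

theorem symplecticI_apply_ne_zero {p q : Fin N × Fin 2} (h : symplecticI N R p q ≠ 0) :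
    p.1 = q.1 ∧ p.2 ≠ q.2 := by
  obtain ⟨i, a⟩ := p
  obtain ⟨j, b⟩ := q
  by_cases hij : i = j
  · subst hij
    refine ⟨rfl, ?_⟩
    rintro hab
    simp only at hab
    subst hab
    fin_cases a <;> simp [symplecticI] at h
  · simp [symplecticI, hij] at h

theorem symplecticI_perm (i : Fin N) (s : Equiv.Perm (Fin 2)) :
    symplecticI N R (i, s 0) (i, s 1) = ((Equiv.Perm.sign s : ℤ) : R) := by
  have : s = 1 ∨ s = Equiv.swap 0 1 := by revert s; decide
  rcases this with rfl | rfl <;> simp [symplecticI]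

/-- The nonzero terms are the permutations mapping blocks to blocks: a permutation l of the blocks
and a permutation s_j inside each. Every such term is 1, because sign l occurs twice and each sign
s_j cancels against the matrix entry. Hence the value N!·2^N. -/
theorem sum_sign_prod_symplecticI :
    (∑ ω : Equiv.Perm (Fin N × Fin 2), ((Equiv.Perm.sign ω : ℤ) : R) *
        ∏ j, symplecticI N R (ω (j, 0)) (ω (j, 1))) = ((N.factorial * 2 ^ N : ℕ) : R) := by
  have hc : ((N.factorial * 2 ^ N : ℕ) : R) =
      ∑ _x : Equiv.Perm (Fin N) × (Fin N → Equiv.Perm (Fin 2)), (1 : R) := by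
    simp [Fintype.card_perm]
  rw [hc]
  symm
  refine Fintype.sum_of_injective
    (fun x : Equiv.Perm (Fin N) × (Fin N → Equiv.Perm (Fin 2)) =>
      (Equiv.prodCongrLeft fun _ => x.1) * (Equiv.prodCongrRight x.2)) ?_ _ _ ?_ ?_
  · rintro ⟨l, s⟩ ⟨l', s'⟩ h
    have h1 : ∀ j b, (l j, s j b) = (l' j, s' j b) := fun j b =>
      congrArg (fun ω : Equiv.Perm (Fin N × Fin 2) => ω (j, b)) h
    simp only [Prod.mk.injEq] at h1 ⊢
    exact ⟨Equiv.ext fun j => (h1 j 0).1, funext fun j => Equiv.ext fun b => (h1 j b).2⟩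
  · intro ω hω
    by_contra hne
    apply hω
    have hJ : ∀ j, symplecticI N R (ω (j, 0)) (ω (j, 1)) ≠ 0 := fun j hj =>
      hne (by rw [Finset.prod_eq_zero (Finset.mem_univ j) hj, mul_zero])
    have h1 : ∀ j b, (ω (j, b)).1 = (ω (j, 0)).1 := by
      intro j b
      fin_cases b
      · rfl
      · exact (symplecticI_apply_ne_zero (hJ j)).1.symm
    have h2 : ∀ j, Function.Injective fun b => (ω (j, b)).2 := by
      intro j b b' hb
      have : ω (j, b) = ω (j, b') := Prod.ext ((h1 j b).trans (h1 j b').symm) hb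
      exact (Prod.mk.inj (ω.injective this)).2
    have h3 : Function.Injective fun j => (ω (j, 0)).1 := by
      intro j j' hj
      simp only at hj
      obtain ⟨b, hb⟩ := (Finite.injective_iff_surjective.1 (h2 j)) (ω (j', 0)).2
      have : ω (j, b) = ω (j', 0) := Prod.ext ((h1 j b).trans hj) hb
      exact (Prod.mk.inj (ω.injective this)).1
    refine ⟨(Equiv.ofBijective _ (Finite.injective_iff_bijective.1 h3),
      fun j => Equiv.ofBijective _ (Finite.injective_iff_bijective.1 (h2 j))), ?_⟩
    ext1 ⟨j, b⟩
    exact Prod.ext (h1 j b).symm rfl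
  · rintro ⟨l, s⟩
    simp only [Equiv.Perm.sign_mul, Equiv.Perm.sign_prodCongrLeft, Equiv.Perm.sign_prodCongrRight,
      Equiv.Perm.mul_apply]
    have : ∀ j, symplecticI N R (Equiv.prodCongrLeft (fun _ => l) (Equiv.prodCongrRight s (j, 0)))
        (Equiv.prodCongrLeft (fun _ => l) (Equiv.prodCongrRight s (j, 1))) =
        ((Equiv.Perm.sign (s j) : ℤ) : R) := fun j => symplecticI_perm (l j) (s j)
    simp_rw [this]
    push_cast
    rw [Fin.prod_univ_two, mul_assoc, ← Finset.prod_mul_distrib]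
    simp [← Int.cast_mul]

theorem pfaffian_symplecticI [Algebra ℚ R] : pfaffian (symplecticI N R) = 1 := by
  rw [pfaffian, sum_sign_prod_symplecticI, ← map_natCast (algebraMap ℚ R), Algebra.smul_def,
    ← map_mul, ← map_one (algebraMap ℚ R)]
  congr 1
  push_cast
  exact inv_mul_cancel₀ (by positivity)

theorem pfaffian_map {S : Type} [CommRing S] [Algebra ℚ R] [Algebra ℚ S] (φ : R →+* S)
    (C : Matrix (Fin N × Fin 2) (Fin N × Fin 2) R) : φ (pfaffian C) = pfaffian (C.map φ) := by
  rw [pfaffian, pfaffian, map_rat_smul φ]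
  simp [map_sum, map_prod]

theorem symplecticI_map {S : Type} [CommRing S] (φ : R →+* S) :
    (symplecticI N R).map φ = symplecticI N S := by
  ext ⟨i, a⟩ ⟨j, b⟩
  by_cases h : i = j
  · fin_cases a <;> fin_cases b <;> simp [symplecticI, h]
  · simp [symplecticI, h]

end Pfaffian


/-! ### Matrices over `ℝ`, `ℂ`, `ℍ` and their coordinates -/

section Coordinates

open Matrix

variable {β : DysonIndex} {n k l : ℕ}

theorem symplecticI_mul_mul_apply (A : Matrix (Fin n × Fin 2) (Fin k × Fin 2) ℂ) (p q) :
    (symplecticI n ℂ * A * symplecticI k ℂ) p q =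
      ∑ a, ∑ b, (!![0, 1; -1, 0] : Matrix (Fin 2) (Fin 2) ℂ) p.2 a * A (p.1, a) (q.1, b) *
        (!![0, 1; -1, 0] : Matrix (Fin 2) (Fin 2) ℂ) b q.2 := by
  simp only [Matrix.mul_apply, Fintype.sum_prod_type, symplecticI, Matrix.of_apply, ite_mul, zero_mul,
    mul_ite, mul_zero]
  rw [Finset.sum_eq_single q.1]
  · simp only [if_true]
    rw [Finset.sum_comm]
    simp_rw [← Finset.sum_mul]
    refine Finset.sum_congr rfl fun b _ => ?_
    congr 1
    rw [Finset.sum_eq_single p.1]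
    · simp
    · intro i _ hi
      simp [Ne.symm hi]
    · simp
  · intro j _ hj
    simp [hj]
  · simp

/-- The workable form of the quaternionic condition: the second row of each 2 × 2 block is
determined by the first. -/
theorem inGl_four_iff (A : CMat .four n k ℂ) : InGl .four A ↔
    ∀ i j, A (i, 1) (j, 1) = star (A (i, 0) (j, 0)) ∧ A (i, 1) (j, 0) = -star (A (i, 0) (j, 1)) := by
  simp only [InGl]
  rw [← Matrix.ext_iff]
  simp only [Matrix.neg_apply, Matrix.map_apply]
  constructor
  · intro h i j
    have h1 := h (i, 0) (j, 0)
    have h2 := h (i, 0) (j, 1)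
    rw [symplecticI_mul_mul_apply] at h1 h2
    simp at h1 h2
    constructor
    · simp [h1]
    · simp [h2]
  · rintro h ⟨i, a⟩ ⟨j, b⟩
    obtain ⟨h1, h2⟩ := h i j
    rw [symplecticI_mul_mul_apply]
    fin_cases a <;> fin_cases b <;> simp [h1, h2]

theorem InGl.add {A B : CMat β n k ℂ} (hA : InGl β A) (hB : InGl β B) : InGl β (A + B) := by
  cases β
  · simp only [InGl] at *
    rw [Matrix.map_add _ star_add, hA, hB]
  · trivial
  · rw [inGl_four_iff] at *
    intro i j
    simp [hA i j, hB i j]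
    ring

theorem InGl.real_smul {A : CMat β n k ℂ} (r : ℝ) (hA : InGl β A) : InGl β (r • A) := by
  cases β
  · simp only [InGl] at *
    conv_rhs => rw [← hA]
    ext p q
    simp
  · trivial
  · rw [inGl_four_iff] at *
    intro i j
    simp [hA i j]

theorem InGl.neg {A : CMat β n k ℂ} (hA : InGl β A) : InGl β (-A) := by
  simpa using hA.real_smul (-1)

theorem InGl.sub {A B : CMat β n k ℂ} (hA : InGl β A) (hB : InGl β B) : InGl β (A - B) := by
  rw [sub_eq_add_neg]
  exact hA.add hB.neg

variable (β) in
/-- The matrix over `ℝ`, `ℂ`, `ℍ` given by a real matrix. -/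
noncomputable def realMat (M : Matrix (Fin n) (Fin k) ℝ) : CMat β n k ℂ :=
  Matrix.of fun p q => (M p.1 q.1 : ℂ) * (1 : Matrix (Fin (gam β)) (Fin (gam β)) ℂ) p.2 q.2

theorem realMat_apply (M : Matrix (Fin n) (Fin k) ℝ) (p q) :
    realMat β M p q = (M p.1 q.1 : ℂ) * (1 : Matrix (Fin (gam β)) (Fin (gam β)) ℂ) p.2 q.2 := rfl

theorem realMat_mul (M : Matrix (Fin n) (Fin k) ℝ) (M' : Matrix (Fin k) (Fin l) ℝ) :
    realMat β (M * M') = realMat β M * realMat β M' := by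
  ext p q
  simp only [realMat_apply, Matrix.mul_apply, Fintype.sum_prod_type, Complex.ofReal_sum,
    Complex.ofReal_mul, Finset.sum_mul]
  refine Finset.sum_congr rfl fun j _ => ?_
  simp [Matrix.one_apply]

theorem realMat_one : realMat β (1 : Matrix (Fin n) (Fin n) ℝ) = 1 := by
  ext ⟨i, a⟩ ⟨j, b⟩
  simp only [realMat_apply, Matrix.one_apply, Prod.mk.injEq]
  split_ifs <;> simp_all

theorem realMat_conjTranspose (M : Matrix (Fin n) (Fin k) ℝ) :
    (realMat β M)ᴴ = realMat β Mᵀ := by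
  ext ⟨i, a⟩ ⟨j, b⟩
  simp only [realMat_apply, Matrix.one_apply, Matrix.conjTranspose_apply, Matrix.transpose_apply,
    eq_comm (a := a)]
  split_ifs <;> simp

theorem InGl.realMat (M : Matrix (Fin n) (Fin k) ℝ) : InGl β (realMat β M) := by
  cases β
  · simp only [InGl]
    ext ⟨i, a⟩ ⟨j, b⟩
    fin_cases a; fin_cases b
    simp [realMat_apply]
  · trivial
  · rw [inGl_four_iff]
    intro i j
    simp [realMat_apply]

variable (β) in
/-- The matrix with given real coordinates. -/
noncomputable def toMat (x : Coord β n k → ℝ) : CMat β n k ℂ := ofCoords β fun c => (x c : ℂ)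

theorem inGl_toMat (x : Coord β n k → ℝ) : InGl β (toMat β x) := by
  cases β
  · simp only [InGl]
    ext ⟨i, a⟩ ⟨j, b⟩
    fin_cases a; fin_cases b
    simp [toMat, ofCoords, basisMat]
  · trivial
  · rw [inGl_four_iff]
    intro i j
    simp [toMat, ofCoords, basisMat, Fin.sum_univ_four]
    ring

theorem coords_toMat (x : Coord β n k → ℝ) : coords β (toMat β x) = x := by
  ext ⟨i, j, c⟩
  cases β
  · fin_cases c
    simp [coords, toMat, ofCoords, basisMat]
  · fin_cases c <;> simp [coords, toMat, ofCoords, basisMat]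
  · fin_cases c <;> simp [coords, toMat, ofCoords, basisMat, Fin.sum_univ_four] <;> rfl

theorem toMat_coords {A : CMat β n k ℂ} (hA : InGl β A) : toMat β (coords β A) = A := by
  ext ⟨i, a⟩ ⟨j, b⟩
  cases β
  · fin_cases a; fin_cases b
    simp only [InGl] at hA
    have := congrFun (congrFun hA (i, 0)) (j, 0)
    simp only [Matrix.map_apply] at this
    simpa [coords, toMat, ofCoords, basisMat] using Complex.conj_eq_iff_re.1 this
  · fin_cases a; fin_cases b
    simp [coords, toMat, ofCoords, basisMat]
  · rw [inGl_four_iff] at hA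
    obtain ⟨h1, h2⟩ := hA i j
    fin_cases a <;> fin_cases b <;>
      apply Complex.ext <;>
      simp [coords, toMat, ofCoords, basisMat, Fin.sum_univ_four, h1, h2]

theorem coords_add (A B : CMat β n k ℂ) : coords β (A + B) = coords β A + coords β B := by
  ext ⟨i, j, c⟩
  cases β
  · simp [coords]
  · fin_cases c <;> simp [coords]
  · fin_cases c <;> simp [coords]

theorem coords_real_smul (r : ℝ) (A : CMat β n k ℂ) : coords β (r • A) = r • coords β A := by
  ext ⟨i, j, c⟩
  cases β
  · simp [coords]
  · fin_cases c <;> simp [coords]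
  · fin_cases c <;> simp [coords]

variable (β n k) in
/-- The real coordinates as a linear map. -/
noncomputable def coordsLM : CMat β n k ℂ →ₗ[ℝ] Coord β n k → ℝ where
  toFun := coords β
  map_add' := coords_add
  map_smul' := coords_real_smul

variable (β n k) in
/-- The matrix with given real coordinates, as a linear map. -/
noncomputable def toMatLM : (Coord β n k → ℝ) →ₗ[ℝ] CMat β n k ℂ where
  toFun := toMat β
  map_add' x y := by
    ext p q
    simp [toMat, ofCoords, add_mul, Finset.sum_add_distrib]
  map_smul' r x := by
    ext p q
    simp [toMat, ofCoords, Finset.mul_sum, mul_assoc]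

theorem continuous_coords : Continuous (coords β : CMat β n k ℂ → Coord β n k → ℝ) :=
  (coordsLM β n k).continuous_of_finiteDimensional

/-- Orthogonality of the real basis; the norm 2γ is what the factor 1/(2γ) in the exponent of Ψ̂
normalises. -/
theorem trace_basisMat (c d : Fin (dim β)) :
    ((basisMat β c)ᴴ * basisMat β d).trace + ((basisMat β d)ᴴ * basisMat β c).trace =
      if c = d then (2 * gam β : ℂ) else 0 := by
  cases β
  · fin_cases c; fin_cases d
    simp [basisMat]
    norm_num
  · fin_cases c <;> fin_cases d <;> simp [basisMat, Matrix.trace, Matrix.mul_apply] <;> norm_num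
  · fin_cases c <;> fin_cases d <;>
      simp [basisMat, Matrix.trace, Matrix.mul_apply, Fin.sum_univ_two] <;> norm_num

theorem trace_toMat (x y : Coord β n k → ℝ) : ((toMat β x)ᴴ * toMat β y).trace =
    ∑ i, ∑ j, ∑ c, ∑ d, (x (i, j, c) * y (i, j, d) : ℂ) * ((basisMat β c)ᴴ * basisMat β d).trace := by
  have h : ∀ i j, ∑ c, ∑ d, (x (i, j, c) * y (i, j, d) : ℂ) *
      ((basisMat β c)ᴴ * basisMat β d).trace =
        ∑ b, ∑ a, star (toMat β x (i, a) (j, b)) * toMat β y (i, a) (j, b) := by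
    intro i j
    have : (∑ c, (x (i, j, c) : ℂ) • basisMat β c)ᴴ * (∑ d, (y (i, j, d) : ℂ) • basisMat β d) =
        ∑ c, ∑ d, (x (i, j, c) * y (i, j, d) : ℂ) • ((basisMat β c)ᴴ * basisMat β d) := by
      simp only [Matrix.conjTranspose_sum, Matrix.conjTranspose_smul, Matrix.sum_mul, Matrix.mul_sum,
        Matrix.smul_mul, Matrix.mul_smul, Finset.smul_sum, smul_smul, Complex.star_def, Complex.conj_ofReal]
      rw [Finset.sum_comm]
      simp only [mul_comm]
    have h2 := congrArg Matrix.trace this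
    simp only [Matrix.trace_sum, Matrix.trace_smul, smul_eq_mul] at h2
    rw [← h2]
    simp [Matrix.trace, Matrix.mul_apply, Matrix.sum_apply, toMat, ofCoords]
  simp_rw [h, Matrix.trace, Matrix.diag_apply, Matrix.mul_apply, Matrix.conjTranspose_apply,
    Fintype.sum_prod_type]
  conv_rhs => rw [Finset.sum_comm]
  exact Finset.sum_congr rfl fun j _ => Finset.sum_comm

theorem trace_add_trace {A B : CMat β n k ℂ} (hA : InGl β A) (hB : InGl β B) :
    (Bᴴ * A).trace + (Aᴴ * B).trace = 2 * gam β * ∑ c, (coords β B c * coords β A c : ℂ) := by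
  rw [← toMat_coords hA, ← toMat_coords hB, trace_toMat, trace_toMat]
  simp only [coords_toMat]
  generalize coords β A = x
  generalize coords β B = y
  simp only [Fintype.sum_prod_type, Finset.mul_sum, ← Finset.sum_add_distrib]
  refine Finset.sum_congr rfl fun i _ => Finset.sum_congr rfl fun j _ => ?_
  simp only [Finset.sum_add_distrib]
  rw [add_comm, Finset.sum_comm, ← Finset.sum_add_distrib]
  refine Finset.sum_congr rfl fun c _ => ?_
  rw [← Finset.sum_add_distrib, Finset.sum_eq_single c]
  · have := trace_basisMat c c
    rw [if_pos rfl] at this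
    rw [mul_comm (y _ : ℂ), ← mul_add, this]
    ring
  · intro d _ hd
    have := trace_basisMat d c
    rw [if_neg hd] at this
    rw [mul_comm (y _ : ℂ), ← mul_add, this, mul_zero]
  · simp

theorem re_trace_toMat {A B : CMat β n k ℂ} (hA : InGl β A) (hB : InGl β B) :
    (Bᴴ * A).trace.re = gam β * ∑ c, coords β B c * coords β A c := by
  have h := congrArg Complex.re (trace_add_trace hA hB)
  have h2 : (Aᴴ * B).trace.re = (Bᴴ * A).trace.re := by
    rw [← Complex.conj_re, starRingEnd_apply, ← Matrix.trace_conjTranspose]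
    simp
  rw [Complex.add_re, h2] at h
  have h3 : (2 * gam β * ∑ c, (coords β B c * coords β A c : ℂ)).re =
      2 * gam β * ∑ c, coords β B c * coords β A c := by
    rw [← Complex.ofReal_re (2 * gam β * ∑ c, coords β B c * coords β A c)]
    push_cast
    rfl
  rw [h3] at h
  linarith

end Coordinates


/-! ### Polar and singular value decompositions -/

section Decomposition

open Matrix NormedSpace

variable {β : DysonIndex} {n k : ℕ}

theorem continuous_coe_unitaryGp :
    Continuous fun g : unitaryGp β n => (g.1.1 : CMat β n n ℂ) :=
  continuous_subtype_val.comp continuous_subtype_val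

theorem unitaryGp_conjTranspose_mul (g : unitaryGp β n) :
    ((g.1.1 : CMat β n n ℂ))ᴴ * g.1.1 = 1 :=
  Matrix.mem_unitaryGroup_iff'.1 g.1.2

theorem unitaryGp_mul_conjTranspose (g : unitaryGp β n) :
    (g.1.1 : CMat β n n ℂ) * (g.1.1 : CMat β n n ℂ)ᴴ = 1 :=
  Matrix.mem_unitaryGroup_iff.1 g.1.2

/-- A group element given by its matrix. -/
def unitaryGp.mk (U : CMat β n n ℂ) (hU : InGl β U) (h : Uᴴ * U = 1) : unitaryGp β n :=
  ⟨⟨U, Matrix.mem_unitaryGroup_iff'.2 h⟩, hU⟩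

open scoped Matrix.Norms.Operator in
-- The 𝕂-matrices form a closed real subalgebra, which therefore contains the exponential series.
theorem inGl_exp {X : CMat β n n ℂ} (hX : InGl β X) : InGl β (exp X) := by
  let S : Subalgebra ℝ (CMat β n n ℂ) :=
    { carrier := {A | InGl β A}
      mul_mem' := InGl.mul β
      one_mem' := InGl.one β n
      add_mem' := InGl.add
      zero_mem' := by simpa using (InGl.one β n).real_smul 0
      algebraMap_mem' := fun r => by
        rw [Algebra.algebraMap_eq_smul_one]
        exact (InGl.one β n).real_smul r }
  exact exp_mem (s := S) (InGl.isClosed β n n) hX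

open scoped Matrix.Norms.Operator ComplexOrder in
-- X = S† - S is skew-adjoint, so exp(tX) is a curve in the group. Stationarity at t = 0 gives Re
-- tr(XS) = 0, and tr(X†X) = 2 Re tr(XS), so X = 0. This treats ℝ, ℂ and ℍ alike without spectral
-- theory.
theorem isSelfAdjoint_of_isMax {S : CMat β n n ℂ} (hS : InGl β S)
    (hmax : ∀ g : unitaryGp β n, (g.1.1 * S).trace.re ≤ S.trace.re) : Sᴴ = S := by
  set X : CMat β n n ℂ := Sᴴ - S with hX
  have hXi : InGl β X := hS.conjTranspose.sub hS
  have hXs : Xᴴ = -X := by simp [hX]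
  have hmem : ∀ t : ℝ, (exp (t • X))ᴴ * exp (t • X) = 1 := by
    intro t
    rw [← Matrix.exp_conjTranspose, Matrix.conjTranspose_smul, hXs, smul_neg]
    simp only [star_trivial]
    rw [← Matrix.exp_add_of_commute _ _ (Commute.refl (t • X)).neg_left]
    simp
  let L : CMat β n n ℂ →L[ℝ] ℝ := LinearMap.toContinuousLinearMap
    { toFun := fun A => (A * S).trace.re
      map_add' := fun A B => by simp [add_mul]
      map_smul' := fun r A => by simp }
  have hd : HasDerivAt (fun t : ℝ => L (exp (t • X))) (L X) 0 := by
    have := hasDerivAt_exp_smul_const (𝕂 := ℝ) X 0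
    rw [zero_smul, exp_zero, one_mul] at this
    exact L.hasFDerivAt.comp_hasDerivAt _ this
  have hm : IsLocalMax (fun t : ℝ => L (exp (t • X))) 0 := by
    refine Filter.Eventually.of_forall fun t => ?_
    have := hmax (unitaryGp.mk _ (inGl_exp (hXi.real_smul t)) (hmem t))
    simpa [L, unitaryGp.mk] using this
  have h0 : (X * S).trace.re = 0 := hm.hasDerivAt_eq_zero hd
  have h1 : (Xᴴ * X).trace.re = 0 := by
    have e1 : (Sᴴ * Sᴴ).trace.re = (S * S).trace.re := by
      rw [← Matrix.conjTranspose_mul, Matrix.trace_conjTranspose]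
      simp
    have e2 : (S * Sᴴ).trace.re = (Sᴴ * S).trace.re := by rw [Matrix.trace_mul_comm]
    have e3 : (Sᴴ * S).trace.re = (S * S).trace.re := by
      simpa [hX, sub_mul, sub_eq_zero] using h0
    rw [hXs, hX]
    simp only [neg_sub, sub_mul, mul_sub, Matrix.trace_sub, Complex.sub_re, e1, e2, e3]
    ring
  have h2 : (Xᴴ * X).trace = 0 := by
    have := (Matrix.posSemidef_conjTranspose_mul_self X).trace_nonneg
    exact Complex.ext h1 (Complex.nonneg_iff.1 this).2.symm
  have h3 := Matrix.trace_conjTranspose_mul_self_eq_zero_iff.1 h2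
  exact sub_eq_zero.1 (hX ▸ h3)

theorem isSelfAdjoint_mul_of_isMax {C : CMat β n n ℂ} (hC : InGl β C) (g : unitaryGp β n)
    (hmax : ∀ g' : unitaryGp β n, (g'.1.1 * C).trace.re ≤ (g.1.1 * C).trace.re) :
    (g.1.1 * C)ᴴ = g.1.1 * C :=
  isSelfAdjoint_of_isMax (g.2.mul β hC) fun g' => by
    rw [← Matrix.mul_assoc]
    exact hmax (g' * g)

/-- A polar decomposition without positivity: maximise Re tr(gC) over the compact group. -/
theorem exists_isSelfAdjoint_mul {C : CMat β n n ℂ} (hC : InGl β C) :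
    ∃ g : unitaryGp β n, (g.1.1 * C)ᴴ = g.1.1 * C := by
  obtain ⟨g, -, hg⟩ := isCompact_univ.exists_isMaxOn (Set.univ_nonempty (α := unitaryGp β n))
    (f := fun g : unitaryGp β n => (g.1.1 * C).trace.re)
    (Complex.continuous_re.comp
      (continuous_coe_unitaryGp.matrix_mul continuous_const).matrix_trace).continuousOn
  exact ⟨g, isSelfAdjoint_mul_of_isMax hC g fun g' => hg (Set.mem_univ g')⟩

/-- A self-adjoint scalar of ℝ, ℂ or ℍ is real. In the quaternionic case the off-diagonal entry of
the block equals its own negative. -/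
theorem eq_realMat_diagonal {S : CMat β k k ℂ} (hS : InGl β S) (hs : Sᴴ = S)
    (h0 : ∀ p q, p.1 ≠ q.1 → S p q = 0) : ∃ s : Fin k → ℝ, S = realMat β (diagonal s) := by
  refine ⟨fun j => (S (j, ⟨0, gam_pos β⟩) (j, ⟨0, gam_pos β⟩)).re, ?_⟩
  ext ⟨i, a⟩ ⟨j, b⟩
  by_cases hij : i = j
  · subst hij
    have hre : ∀ p, (S p p).im = 0 := fun p => by
      have := congrFun (congrFun hs p) p
      rw [Matrix.conjTranspose_apply] at this
      exact Complex.conj_eq_iff_im.1 this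
    rw [realMat_apply]
    cases β
    · fin_cases a; fin_cases b
      apply Complex.ext <;> simp [hre]
    · fin_cases a; fin_cases b
      apply Complex.ext <;> simp [hre]
    · rw [inGl_four_iff] at hS
      obtain ⟨h1, h2⟩ := hS i i
      have h3 := congrFun (congrFun hs (i, 1)) (i, 0)
      rw [Matrix.conjTranspose_apply, h2] at h3
      have h4 : S (i, 0) (i, 1) = 0 := by
        have : (2 : ℂ) * star (S (i, 0) (i, 1)) = 0 := by linear_combination h3
        simpa using this
      have h5 : S (i, 1) (i, 0) = 0 := by rw [h2, h4]; simp
      have h6 := Complex.conj_eq_iff_im.2 (hre (i, 0))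
      have h7 : S (i, 0) (i, 0) = ((S (i, 0) (i, 0)).re : ℂ) := (Complex.conj_eq_iff_re.1 h6).symm
      fin_cases a <;> fin_cases b
      · simpa using h7
      · simpa using h4
      · simpa using h5
      · simp only [Complex.star_def] at h1
        simp only [Fin.mk_one, h1, h6]
        simpa using h7
  · rw [h0 _ _ hij, realMat_apply]
    simp [hij]

theorem realMat_diagonal_mul_apply (w : Fin k → ℝ) (S : CMat β k n ℂ) (p q) :
    (realMat β (diagonal w) * S) p q = w p.1 * S p q := by
  simp only [Matrix.mul_apply, Fintype.sum_prod_type, realMat_apply, diagonal_apply, one_apply]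
  rw [Finset.sum_eq_single p.1, Finset.sum_eq_single p.2]
  · simp
  · intro b _ hb
    simp [hb.symm]
  · simp
  · intro b _ hb
    simp [hb.symm]
  · simp

theorem mul_realMat_diagonal_apply (w : Fin k → ℝ) (S : CMat β n k ℂ) (p q) :
    (S * realMat β (diagonal w)) p q = S p q * w q.1 := by
  simp only [Matrix.mul_apply, Fintype.sum_prod_type, realMat_apply, diagonal_apply, one_apply]
  rw [Finset.sum_eq_single q.1, Finset.sum_eq_single q.2]
  · simp
  · intro b _ hb
    simp [hb]
  · simp
  · intro b _ hb
    simp [hb]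
  · simp

variable (β) in
/-- The inclusion of the first `k` basis vectors. -/
noncomputable def incl (hk : k ≤ n) : CMat β n k ℂ :=
  realMat β (Matrix.of fun i j => if i = Fin.castLE hk j then 1 else 0)

theorem incl_inGl (hk : k ≤ n) : InGl β (incl β hk) := InGl.realMat _

theorem incl_conjTranspose_mul (hk : k ≤ n) : (incl β hk)ᴴ * incl β hk = 1 := by
  rw [incl, realMat_conjTranspose, ← realMat_mul, ← realMat_one]
  congr 1
  ext i j
  simp [Matrix.mul_apply, Matrix.one_apply, eq_comm]

theorem mul_incl_apply {R : Type} [Fintype R] (hk : k ≤ n) (X : Matrix R (Fin n × Fin (gam β)) ℂ)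
    (p : R) (q) : (X * incl β hk) p q = X p (Fin.castLE hk q.1, q.2) := by
  simp only [Matrix.mul_apply, Fintype.sum_prod_type, incl, realMat_apply, of_apply, one_apply]
  rw [Finset.sum_eq_single (Fin.castLE hk q.1), Finset.sum_eq_single q.2]
  · simp
  · intro a _ ha
    simp [ha]
  · simp
  · intro i _ hi
    simp [hi]
  · simp

theorem firstCols_eq (hk : k ≤ n) (U : unitaryGp β n) : firstCols β hk U = U.1.1 * incl β hk := by
  ext p q
  rw [mul_incl_apply]
  rfl

/-- The group element acting as `h` on the span of the first `k` basis vectors, and trivially on its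
orthogonal complement. -/
noncomputable def extend (hk : k ≤ n) (h : unitaryGp β k) : unitaryGp β n :=
  unitaryGp.mk (incl β hk * h.1.1 * (incl β hk)ᴴ + (1 - incl β hk * (incl β hk)ᴴ))
    ((((incl_inGl hk).mul β h.2).mul β (incl_inGl hk).conjTranspose).add
      ((InGl.one β n).sub ((incl_inGl hk).mul β (incl_inGl hk).conjTranspose))) (by
    have e := incl_conjTranspose_mul (β := β) hk
    have e' : ∀ Y : CMat β k n ℂ, (incl β hk)ᴴ * (incl β hk * Y) = Y := fun Y => by
      rw [← Matrix.mul_assoc, e, Matrix.one_mul]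
    have f : ∀ Y : CMat β k n ℂ, (h.1.1 : CMat β k k ℂ)ᴴ * (h.1.1 * Y) = Y := fun Y => by
      rw [← Matrix.mul_assoc, unitaryGp_conjTranspose_mul, Matrix.one_mul]
    simp only [Matrix.conjTranspose_add, Matrix.conjTranspose_sub, Matrix.conjTranspose_mul,
      Matrix.conjTranspose_conjTranspose, Matrix.conjTranspose_one, Matrix.add_mul, Matrix.mul_add,
      Matrix.sub_mul, Matrix.mul_sub, Matrix.mul_assoc, Matrix.one_mul, Matrix.mul_one, e', f]
    abel)

/-- Right multiplication by h on the Stiefel manifold thereby lifts to right translation on the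
large group. -/
theorem extend_mul_incl (hk : k ≤ n) (h : unitaryGp β k) :
    (extend hk h).1.1 * incl β hk = incl β hk * h.1.1 := by
  simp only [extend, unitaryGp.mk, Matrix.add_mul, Matrix.sub_mul, Matrix.mul_assoc,
    incl_conjTranspose_mul, Matrix.one_mul, Matrix.mul_one]
  abel

/-- Let e be the first basis vector and choose g with g v e† self-adjoint. Then g v = e q† with q =
e†gv a scalar, and q = q† makes it real. -/
theorem exists_eq_smul_mul (v : CMat β n 1 ℂ) (hv : InGl β v) (hn : 1 ≤ n) :
    ∃ (g : unitaryGp β n) (r : ℝ), v = r • (g.1.1 * incl β hn) := by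
  have hi := incl_inGl (β := β) hn
  have he := incl_conjTranspose_mul (β := β) hn
  obtain ⟨g, hg⟩ := exists_isSelfAdjoint_mul (hv.mul β hi.conjTranspose)
  rw [Matrix.conjTranspose_mul, Matrix.conjTranspose_mul, Matrix.conjTranspose_conjTranspose] at hg
  set q : CMat β 1 1 ℂ := (incl β hn)ᴴ * g.1.1 * v with hq
  have h1 : g.1.1 * v = incl β hn * qᴴ := by
    calc g.1.1 * v = g.1.1 * (v * (incl β hn)ᴴ) * incl β hn := by
          rw [Matrix.mul_assoc, Matrix.mul_assoc, he, Matrix.mul_one]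
      _ = _ := by
          rw [← hg, hq]
          simp only [Matrix.conjTranspose_mul, Matrix.conjTranspose_conjTranspose, Matrix.mul_assoc]
  have h2 : q = qᴴ := by
    conv_lhs => rw [hq, Matrix.mul_assoc, h1, ← Matrix.mul_assoc, he, Matrix.one_mul]
  obtain ⟨s, hs⟩ := eq_realMat_diagonal ((hi.conjTranspose.mul β g.2).mul β hv) h2.symm
    (fun p q hpq => (hpq (Subsingleton.elim _ _)).elim)
  refine ⟨g⁻¹, s 0, ?_⟩
  have h3 : v = (g⁻¹).1.1 * (g.1.1 * v) := by
    rw [← Matrix.mul_assoc]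
    have : (g⁻¹).1.1 * g.1.1 = 1 := unitaryGp_conjTranspose_mul g
    rw [this, Matrix.one_mul]
  conv_lhs => rw [h3, h1, ← h2, hq, hs, ← Matrix.mul_assoc]
  ext p q
  rw [mul_realMat_diagonal_apply, Matrix.smul_apply, Subsingleton.elim q.1 0, mul_comm]
  simp

/-- Maximise Re tr(D E† g B h) over both groups, where D is diagonal with distinct positive weights
and E = `incl`. With M = gBh, stationarity in g makes M D E† self-adjoint and stationarity in h
makes D E† M self-adjoint. The first gives M = E S with S D self-adjoint, the second that D S is
self-adjoint; distinct weights then force S to be diagonal. -/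
theorem exists_svd (hk : k ≤ n) (B : CMat β n k ℂ) (hB : InGl β B) :
    ∃ (g : unitaryGp β n) (h : unitaryGp β k) (s : Fin k → ℝ),
      g.1.1 * B * h.1.1 = incl β hk * realMat β (diagonal s) := by
  set E := incl β hk with hE
  have hEi : InGl β E := incl_inGl hk
  have he : Eᴴ * E = 1 := incl_conjTranspose_mul hk
  -- Distinct positive weights, so that w_p² = w_q² only for p = q.
  set w : Fin k → ℝ := fun j => (j : ℝ) + 1 with hw
  have hwpos : ∀ j, 0 < w j := fun j => by positivity
  set D := realMat β (diagonal w) with hD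
  have hDs : Dᴴ = D := by rw [hD, realMat_conjTranspose, diagonal_transpose]
  set D' := realMat β (diagonal fun j => (w j)⁻¹) with hD'
  have hDD : D * D' = 1 := by
    rw [hD, hD', ← realMat_mul, diagonal_mul_diagonal, ← realMat_one, ← diagonal_one]
    congr 2
    ext j
    exact mul_inv_cancel₀ (hwpos j).ne'
  have hDi : InGl β D := InGl.realMat _
  obtain ⟨⟨g, h⟩, -, hgh⟩ := isCompact_univ.exists_isMaxOn
    (Set.univ_nonempty (α := unitaryGp β n × unitaryGp β k))
    (f := fun x => (D * Eᴴ * (x.1.1.1 * B * x.2.1.1)).trace.re)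
    (Complex.continuous_re.comp (continuous_const.matrix_mul
      (((continuous_coe_unitaryGp.comp continuous_fst).matrix_mul continuous_const).matrix_mul
        (continuous_coe_unitaryGp.comp continuous_snd))).matrix_trace).continuousOn
  have hDE : InGl β (D * Eᴴ) := hDi.mul β hEi.conjTranspose
  have h1 := isSelfAdjoint_mul_of_isMax ((hB.mul β h.2).mul β hDE) g (fun g' => by
    have := hgh (Set.mem_univ (g', h))
    simp only [Set.mem_ofPred_eq] at this
    rw [Matrix.trace_mul_comm, Matrix.trace_mul_comm (D * Eᴴ)] at this
    simpa only [Matrix.mul_assoc] using this)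
  have h2 := isSelfAdjoint_mul_of_isMax ((hDE.mul β g.2).mul β hB) h (fun h' => by
    have := hgh (Set.mem_univ (g, h'))
    simp only [Set.mem_ofPred_eq] at this
    have e : ∀ h : CMat β k k ℂ, (D * Eᴴ * (g.1.1 * B * h)).trace =
        (h * (D * Eᴴ * g.1.1 * B)).trace := fun h => by
      rw [Matrix.trace_mul_comm h]
      simp only [Matrix.mul_assoc]
    rwa [e, e] at this)
  set M := g.1.1 * B * h.1.1 with hM
  have h1' : E * (D * Mᴴ) = M * (D * Eᴴ) := by
    have : g.1.1 * (B * h.1.1 * (D * Eᴴ)) = M * (D * Eᴴ) := by simp only [hM, Matrix.mul_assoc]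
    rw [this] at h1
    rw [← h1]
    simp only [Matrix.conjTranspose_mul, Matrix.conjTranspose_conjTranspose, hDs, Matrix.mul_assoc]
  have h2' : Mᴴ * E * D = D * (Eᴴ * M) := by
    have e1 : D * (Eᴴ * M) =
        (h.1.1 : CMat β k k ℂ)ᴴ * (h.1.1 * (D * Eᴴ * g.1.1 * B)) * h.1.1 := by
      rw [← Matrix.mul_assoc _ (h.1.1 : CMat β k k ℂ), unitaryGp_conjTranspose_mul, Matrix.one_mul]
      simp only [hM, Matrix.mul_assoc]
    have e2 : Mᴴ * E * D = (D * (Eᴴ * M))ᴴ := by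
      simp only [Matrix.conjTranspose_mul, Matrix.conjTranspose_conjTranspose, hDs, Matrix.mul_assoc]
    rw [e2, e1, Matrix.conjTranspose_mul, Matrix.conjTranspose_mul, h2,
      Matrix.conjTranspose_conjTranspose]
    simp only [Matrix.mul_assoc]
  set S := Eᴴ * M with hS
  have hSs : Sᴴ = Mᴴ * E := by rw [hS, Matrix.conjTranspose_mul, Matrix.conjTranspose_conjTranspose]
  have hSi : InGl β S := hEi.conjTranspose.mul β ((g.2.mul β hB).mul β h.2)
  rw [← hSs] at h2'
  have h3 : M * D = E * (D * Sᴴ) := by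
    calc M * D = M * (D * Eᴴ) * E := by simp only [Matrix.mul_assoc, he, Matrix.mul_one]
      _ = _ := by rw [← h1', hSs]; simp only [Matrix.mul_assoc]
  have h4 : S * D = D * Sᴴ := by
    rw [hS, Matrix.mul_assoc, h3, ← Matrix.mul_assoc, he, Matrix.one_mul]
  have h5 : M = E * S := by
    calc M = M * D * D' := by rw [Matrix.mul_assoc, hDD, Matrix.mul_one]
      _ = E * (S * D) * D' := by rw [h3, h4]
      _ = _ := by simp only [Matrix.mul_assoc, hDD, Matrix.mul_one]
  have h6 : ∀ p q, S p q * w q.1 = w p.1 * star (S q p) := fun p q => by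
    have := congrFun (congrFun h4 p) q
    rwa [hD, mul_realMat_diagonal_apply, realMat_diagonal_mul_apply] at this
  have h7 : ∀ p q, star (S q p) * w q.1 = w p.1 * S p q := fun p q => by
    have := congrFun (congrFun h2' p) q
    rwa [hD, mul_realMat_diagonal_apply, realMat_diagonal_mul_apply] at this
  have h8 : ∀ p q, p.1 ≠ q.1 → S p q = 0 := by
    intro p q hpq
    -- Eliminating the adjoint entry between `h6` and `h7` leaves S_pq (w_q² - w_p²) = 0.
    have e : S p q * ((w q.1 : ℂ) ^ 2 - (w p.1 : ℂ) ^ 2) = 0 := by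
      linear_combination (w q.1 : ℂ) * h6 p q + (w p.1 : ℂ) * h7 p q
    refine (mul_eq_zero.1 e).resolve_right fun h0 => hpq ?_
    have h9 : (w q.1) ^ 2 = (w p.1) ^ 2 := by
      rw [sub_eq_zero] at h0
      exact_mod_cast h0
    have := (sq_eq_sq₀ (hwpos _).le (hwpos _).le).1 h9
    simp only [hw, add_left_inj, Nat.cast_inj] at this
    exact (Fin.ext this).symm
  have h9 : Sᴴ = S := by
    ext p q
    rw [Matrix.conjTranspose_apply]
    by_cases hpq : p.1 = q.1
    · have := h6 p q
      rw [hpq, mul_comm] at this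
      exact (mul_left_cancel₀ (by exact_mod_cast (hwpos q.1).ne') this).symm
    · rw [h8 p q hpq, h8 q p (Ne.symm hpq), star_zero]
  obtain ⟨s, hs⟩ := eq_realMat_diagonal hSi h9 h8
  exact ⟨g, h, s, by rw [← hs, ← h5]⟩

end Decomposition


/-! ### The invariants -/

section Invariants

open Matrix

variable {β : DysonIndex} {n k : ℕ}

/-- The hypothesis concerns only the products μ·M_pq, so that both a change of base ring and a
rescaling of μ are instances. -/
theorem invGen_ringHom {R S : Type} [CommRing R] [Algebra ℚ R] [CommRing S] [Algebra ℚ S]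
    (Θ : Polynomial R →+* Polynomial S) (M : CMat β k k R) (M' : CMat β k k S)
    (h : ∀ p q, Θ (Polynomial.X * Polynomial.C (M p q)) = Polynomial.X * Polynomial.C (M' p q)) :
    Θ (invGen β M) = invGen β M' := by
  have h1 : (Polynomial.X (R := R) • M.map Polynomial.C).map Θ =
      Polynomial.X (R := S) • M'.map Polynomial.C := by
    ext1 p q
    simpa using h p q
  cases β
  · simp only [invGen]
    rw [RingHom.map_det, RingHom.mapMatrix_apply, Matrix.map_add _ (map_add Θ), h1,
      Matrix.map_one _ (map_zero _) (map_one _)]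
  · simp only [invGen]
    rw [RingHom.map_det, RingHom.mapMatrix_apply, Matrix.map_add _ (map_add Θ), h1,
      Matrix.map_one _ (map_zero _) (map_one _)]
  · simp only [invGen]
    rw [pfaffian_map, Matrix.map_add _ (map_add Θ), ← Matrix.mul_smul, Matrix.map_mul,
      ← Matrix.mul_smul]
    erw [h1]
    rw [symplecticI_map]

theorem invGen_map {R S : Type} [CommRing R] [Algebra ℚ R] [CommRing S] [Algebra ℚ S]
    (φ : R →+* S) (M : CMat β k k R) : (invGen β M).map φ = invGen β (M.map φ) :=
  invGen_ringHom (Polynomial.mapRingHom φ) M (M.map φ) fun p q => by simp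

theorem invGen_smul {R : Type} [CommRing R] [Algebra ℚ R] (r : R) (M : CMat β k k R) :
    (invGen β M).comp (Polynomial.C r * Polynomial.X) = invGen β (r • M) :=
  invGen_ringHom (Polynomial.compRingHom (Polynomial.C r * Polynomial.X)) M (r • M) fun p q => by
    simp
    ring

theorem invGen_zero {R : Type} [CommRing R] [Algebra ℚ R] : invGen β (0 : CMat β k k R) = 1 := by
  cases β
  · simp [invGen]
  · simp [invGen]
  · simp only [invGen]
    rw [Matrix.map_zero _ (map_zero _)]
    simp [pfaffian_symplecticI]

theorem symplecticI_transpose (N : ℕ) (R : Type) [CommRing R] :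
    (symplecticI N R)ᵀ = -symplecticI N R := by
  ext ⟨i, a⟩ ⟨j, b⟩
  by_cases h : i = j
  · subst h
    fin_cases a <;> fin_cases b <;> simp [symplecticI]
  · simp [symplecticI, h, Ne.symm h]

theorem symplecticI_mul_conjTranspose {h : Matrix (Fin k × Fin 2) (Fin k × Fin 2) ℂ}
    (hi : InGl (n := k) (k := k) .four h) :
    symplecticI k ℂ * hᴴ = hᵀ * symplecticI k ℂ := by
  have h1 : hᴴ = -(symplecticI k ℂ * hᵀ * symplecticI k ℂ) := by
    have : hᴴ = (h.map star)ᵀ := rfl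
    rw [this]
    simp only [InGl] at hi
    rw [hi]
    simp only [Matrix.transpose_neg, Matrix.transpose_mul, symplecticI_transpose, Matrix.mul_neg,
      Matrix.neg_mul, neg_neg, Matrix.mul_assoc]
  rw [h1, Matrix.mul_neg, Matrix.mul_assoc, ← Matrix.mul_assoc, symplecticI_sq]
  simp

theorem transpose_mul_symplecticI_mul {h : Matrix (Fin k × Fin 2) (Fin k × Fin 2) ℂ}
    (hi : InGl (n := k) (k := k) .four h) (hu : hᴴ * h = 1) :
    hᵀ * symplecticI k ℂ * h = symplecticI k ℂ := by
  rw [← symplecticI_mul_conjTranspose hi, Matrix.mul_assoc, hu, Matrix.mul_one]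

/-- For β = 1, 2 this is similarity invariance of the determinant. For β = 4 one has hᵀJh = J, so J
+ μJh†Mh = hᵀ(J + μJM)h and the Pfaffian changes by det h = 1. -/
theorem invGen_conj (h : unitaryGp β k) (M : CMat β k k ℂ) :
    invGen β ((h.1.1 : CMat β k k ℂ)ᴴ * M * h.1.1) = invGen β M := by
  obtain ⟨⟨h, hu⟩, hi⟩ := h
  replace hu : hᴴ * h = 1 := Matrix.mem_unitaryGroup_iff'.1 hu
  have hdet : ∀ N : CMat β k k ℂ,
      Matrix.det (1 + Polynomial.X (R := ℂ) • (hᴴ * N * h).map Polynomial.C) =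
        Matrix.det (1 + Polynomial.X (R := ℂ) • N.map Polynomial.C) := by
    intro N
    have hu' : hᴴ.map (Polynomial.C (R := ℂ)) * h.map Polynomial.C = 1 := by
      rw [← Matrix.map_mul, hu, Matrix.map_one _ (map_zero _) (map_one _)]
    have e : 1 + Polynomial.X (R := ℂ) • (hᴴ * N * h).map Polynomial.C =
        hᴴ.map Polynomial.C * (1 + Polynomial.X (R := ℂ) • N.map Polynomial.C) *
          h.map Polynomial.C := by
      rw [Matrix.mul_add, Matrix.add_mul, Matrix.mul_one, hu', Matrix.map_mul, Matrix.map_mul,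
        Matrix.mul_smul, Matrix.smul_mul]
    rw [e, Matrix.det_mul_comm, ← Matrix.mul_assoc, mul_eq_one_comm.1 hu', Matrix.one_mul]
  cases β
  · exact hdet M
  · exact hdet M
  · clear hdet
    change Matrix (Fin k × Fin 2) (Fin k × Fin 2) ℂ at h M
    change InGl (n := k) (k := k) .four h at hi
    change pfaffian (symplecticI k (Polynomial ℂ) +
        Polynomial.X (R := ℂ) • (symplecticI k (Polynomial ℂ) * (hᴴ * M * h).map Polynomial.C)) =
      pfaffian (symplecticI k (Polynomial ℂ) +
        Polynomial.X (R := ℂ) • (symplecticI k (Polynomial ℂ) * M.map Polynomial.C))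
    have hJ : symplecticI k (Polynomial ℂ) = (symplecticI k ℂ).map Polynomial.C :=
      (symplecticI_map _).symm
    have e1 : (h.map Polynomial.C)ᵀ * symplecticI k (Polynomial ℂ) * h.map Polynomial.C =
        symplecticI k (Polynomial ℂ) := by
      rw [hJ, ← Matrix.transpose_map, ← Matrix.map_mul, ← Matrix.map_mul,
        transpose_mul_symplecticI_mul hi hu]
    have e2 : symplecticI k (Polynomial ℂ) * (hᴴ * M * h).map Polynomial.C =
        (h.map Polynomial.C)ᵀ * (symplecticI k (Polynomial ℂ) * M.map Polynomial.C) *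
          h.map Polynomial.C := by
      rw [hJ, ← Matrix.transpose_map, ← Matrix.map_mul, ← Matrix.map_mul, ← Matrix.map_mul,
        ← Matrix.map_mul, ← Matrix.mul_assoc hᵀ, ← symplecticI_mul_conjTranspose hi]
      simp only [Matrix.mul_assoc]
    -- Taking Pfaffians in hᵀJh = J gives det h = 1.
    have e3 : (h.map (Polynomial.C (R := ℂ))).det = 1 := by
      have := pfaffian_conj (symplecticI k (Polynomial ℂ)) (h.map Polynomial.C)
      rw [e1, pfaffian_symplecticI, mul_one] at this
      exact this.symm
    have e4 : symplecticI k (Polynomial ℂ) + Polynomial.X (R := ℂ) •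
          (symplecticI k (Polynomial ℂ) * (hᴴ * M * h).map Polynomial.C) =
        (h.map Polynomial.C)ᵀ * (symplecticI k (Polynomial ℂ) +
          Polynomial.X (R := ℂ) • (symplecticI k (Polynomial ℂ) * M.map Polynomial.C)) *
            h.map Polynomial.C := by
      rw [Matrix.mul_add, Matrix.add_mul, e1, e2, Matrix.mul_smul, Matrix.smul_mul]
    rw [e4, pfaffian_conj, e3, one_mul]

theorem invGen_diagonal (d : Fin k → ℝ) :
    invGen β (realMat β (diagonal d)) =
      ∏ j, (1 + Polynomial.X * Polynomial.C (d j : ℂ)) := by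
  have hdet : 1 + Polynomial.X (R := ℂ) • (realMat β (diagonal d)).map Polynomial.C =
      diagonal fun p : Fin k × Fin (gam β) => 1 + Polynomial.X * Polynomial.C (d p.1 : ℂ) := by
    ext1 ⟨i, a⟩ ⟨j, b⟩
    by_cases hij : i = j <;> by_cases hab : a = b <;> simp [realMat_apply, hij, hab]
  cases β
  · simp only [invGen]
    rw [hdet, det_diagonal, Fintype.prod_prod_type]
    simp
  · simp only [invGen]
    rw [hdet, det_diagonal, Fintype.prod_prod_type]
    simp
  · clear hdet
    change pfaffian (symplecticI k (Polynomial ℂ) +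
        Polynomial.X (R := ℂ) • (symplecticI k (Polynomial ℂ) *
          Matrix.map (realMat .four (diagonal d)) Polynomial.C)) = _
    -- Each eigenvalue occurs twice in the complex matrix. Placing its factor in one slot of each
    -- block gives J + μJD = pᵀJp, so the Pfaffian counts it once.
    set p : Fin k × Fin 2 → Polynomial ℂ := fun x =>
      if x.2 = 0 then 1 + Polynomial.X * Polynomial.C (d x.1 : ℂ) else 1 with hp
    have hd : Matrix.map (realMat .four (diagonal d)) Polynomial.C =
        diagonal fun x : Fin k × Fin 2 => Polynomial.C (d x.1 : ℂ) := by
      ext1 ⟨i, a⟩ ⟨j, b⟩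
      by_cases hij : i = j <;> by_cases hab : a = b <;> simp [realMat_apply, hij, hab]
    have e : symplecticI k (Polynomial ℂ) + Polynomial.X (R := ℂ) •
          (symplecticI k (Polynomial ℂ) * Matrix.map (realMat .four (diagonal d)) Polynomial.C) =
        (diagonal p)ᵀ * symplecticI k (Polynomial ℂ) * diagonal p := by
      rw [hd, diagonal_transpose]
      ext1 ⟨i, a⟩ ⟨j, b⟩
      rw [Matrix.mul_diagonal, Matrix.diagonal_mul, Matrix.add_apply, Matrix.smul_apply,
        Matrix.mul_diagonal]
      by_cases hij : i = j
      · subst hij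
        fin_cases a <;> fin_cases b <;> simp [symplecticI, hp]
        ring
      · simp [symplecticI, hij]
    rw [e, pfaffian_conj, pfaffian_symplecticI, mul_one, det_diagonal, Fintype.prod_prod_type]
    simp [hp]

theorem coeff_prod_one_add (d : Fin k → ℂ) (m : ℕ) :
    (∏ j, (1 + Polynomial.X * Polynomial.C (d j))).coeff m =
      MvPolynomial.eval d (MvPolynomial.esymm (Fin k) ℂ m) := by
  rw [Finset.prod_one_add, Polynomial.finsetSum_coeff, MvPolynomial.esymm, map_sum,
    Finset.powersetCard_eq_filter, Finset.sum_filter]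
  refine Finset.sum_congr rfl fun t _ => ?_
  rw [Finset.prod_mul_distrib, Finset.prod_const, ← map_prod, Polynomial.coeff_mul_C,
    Polynomial.coeff_X_pow]
  by_cases h : t.card = m
  · simp [h]
  · simp [h, Ne.symm h]

/-- The value of `I_{j+1}` at a matrix. -/
noncomputable def invVal (B : CMat β n k ℂ) (j : Fin k) : ℂ := (invGen β (Bᴴ * B)).coeff (j + 1)

theorem genericDyadic_apply (p q) : genericDyadic β n k p q =
    ∑ r, adjOfCoords β (n := n) (k := k) MvPolynomial.X p r *
      ofCoords β (n := n) (k := k) MvPolynomial.X r q := rfl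

theorem genericDyadic_map_eval (x : Coord β n k → ℝ) :
    (genericDyadic β n k).map (MvPolynomial.eval fun c => (x c : ℂ)) =
      (toMat β x)ᴴ * toMat β x := by
  ext p q
  rw [Matrix.map_apply, genericDyadic_apply, Matrix.mul_apply, map_sum]
  refine Finset.sum_congr rfl fun r _ => ?_
  simp [adjOfCoords, toMat, ofCoords, MvPolynomial.algebraMap_eq]

theorem eval_invariantPoly (x : Coord β n k → ℝ) (j : Fin k) :
    MvPolynomial.eval (fun c => (x c : ℂ)) (invariantPoly β n k j) = invVal (toMat β x) j := by
  rw [invariantPoly, ← Polynomial.coeff_map, invGen_map, genericDyadic_map_eval, invVal]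

theorem eval_coords_invariantPoly {B : CMat β n k ℂ} (hB : InGl β B) (j : Fin k) :
    MvPolynomial.eval (fun c => (coords β B c : ℂ)) (invariantPoly β n k j) = invVal B j := by
  rw [eval_invariantPoly, toMat_coords hB]

theorem invVal_mul_mul (g : unitaryGp β n) (h : unitaryGp β k) (B : CMat β n k ℂ) :
    invVal (g.1.1 * B * h.1.1) = invVal B := by
  ext j
  rw [invVal, invVal, ← invGen_conj h (Bᴴ * B)]
  congr 2
  have : ∀ Y : CMat β n k ℂ, (g.1.1 : CMat β n n ℂ)ᴴ * (g.1.1 * Y) = Y := fun Y => by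
    rw [← Matrix.mul_assoc, unitaryGp_conjTranspose_mul, Matrix.one_mul]
  simp only [Matrix.conjTranspose_mul, Matrix.mul_assoc, this]

/-- The rectangular diagonal matrix. -/
noncomputable def diagMat (β : DysonIndex) (hk : k ≤ n) (s : Fin k → ℝ) : CMat β n k ℂ :=
  incl β hk * realMat β (diagonal s)

theorem diagMat_inGl (hk : k ≤ n) (s : Fin k → ℝ) : InGl β (diagMat β hk s) :=
  (incl_inGl hk).mul β (InGl.realMat _)

theorem invVal_diagMat (hk : k ≤ n) (s : Fin k → ℝ) (j : Fin k) :
    invVal (diagMat β hk s) j =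
      MvPolynomial.eval (fun i => ((s i ^ 2 : ℝ) : ℂ)) (MvPolynomial.esymm (Fin k) ℂ (j + 1)) := by
  have : (diagMat β hk s)ᴴ * diagMat β hk s = realMat β (diagonal fun i => s i ^ 2) := by
    rw [diagMat, Matrix.conjTranspose_mul, Matrix.mul_assoc, ← Matrix.mul_assoc _ (incl β hk),
      incl_conjTranspose_mul, Matrix.one_mul, realMat_conjTranspose, ← realMat_mul,
      diagonal_transpose, diagonal_mul_diagonal]
    simp_rw [sq]
  rw [invVal, this, invGen_diagonal, coeff_prod_one_add]

theorem toMat_two_mul (x : Coord β n k → ℝ) : toMat β (fun c => 2 * x c) = (2 : ℝ) • toMat β x :=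
  (toMatLM β n k).map_smul (2 : ℝ) x

theorem invVal_real_smul (r : ℝ) (B : CMat β n k ℂ) (j : Fin k) :
    invVal (r • B) j = ((r ^ 2 : ℝ) : ℂ) ^ ((j : ℕ) + 1) * invVal B j := by
  have : (r • B)ᴴ * (r • B) = ((r ^ 2 : ℝ) : ℂ) • (Bᴴ * B) := by
    rw [Matrix.conjTranspose_smul, Matrix.smul_mul, Matrix.mul_smul, smul_smul, star_trivial,
      Complex.coe_smul, sq]
  rw [invVal, this, ← invGen_smul, Polynomial.comp_C_mul_X_coeff, invVal, mul_comm]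

theorem isHomogeneous_invariantPoly (j : Fin k) :
    (invariantPoly β n k j).IsHomogeneous (2 * ((j : ℕ) + 1)) := by
  refine isHomogeneous_of_eval_two fun x => ?_
  rw [eval_invariantPoly, eval_invariantPoly, toMat_two_mul, invVal_real_smul, pow_mul]
  norm_num

theorem isHomogeneous_genericDyadic (p q) : (genericDyadic β n k p q).IsHomogeneous 2 := by
  rw [genericDyadic_apply]
  refine MvPolynomial.IsHomogeneous.sum _ _ _ fun r _ => ?_
  refine MvPolynomial.IsHomogeneous.mul (m := 1) (n := 1) ?_ ?_ <;>
  · simp only [adjOfCoords, ofCoords, Matrix.of_apply, MvPolynomial.algebraMap_eq]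
    refine MvPolynomial.IsHomogeneous.sum _ _ _ fun c _ => ?_
    exact (MvPolynomial.isHomogeneous_X _ _).mul (n := 0) (MvPolynomial.isHomogeneous_C _ _)

/-- The ideal generated by the entries of `X† X`. -/
noncomputable def dyadicIdeal (β : DysonIndex) (n k : ℕ) : Ideal (Poly β n k) :=
  Ideal.span (Set.range fun pq : (Fin k × Fin (gam β)) × (Fin k × Fin (gam β)) =>
    genericDyadic β n k pq.1 pq.2)

theorem genericDyadic_mem (p q) : genericDyadic β n k p q ∈ dyadicIdeal β n k :=
  Ideal.subset_span ⟨(p, q), rfl⟩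

/-- Modulo the ideal X†X is 0 and the generating polynomial becomes 1, so its higher coefficients
vanish. -/
theorem invariantPoly_mem (j : Fin k) : invariantPoly β n k j ∈ dyadicIdeal β n k := by
  rw [← Ideal.Quotient.eq_zero_iff_mem, invariantPoly, ← Polynomial.coeff_map, invGen_map]
  have : (genericDyadic β n k).map (Ideal.Quotient.mk (dyadicIdeal β n k)) = 0 := by
    ext p q
    exact Ideal.Quotient.eq_zero_iff_mem.2 (genericDyadic_mem p q)
  rw [this, invGen_zero, Polynomial.coeff_one, if_neg (Nat.succ_ne_zero _)]

theorem map_conj_genericDyadic (p q) :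
    MvPolynomial.map (starRingEnd ℂ) (genericDyadic β n k p q) = genericDyadic β n k q p := by
  simp only [genericDyadic_apply, map_sum, map_mul, adjOfCoords, ofCoords,
    Matrix.of_apply, MvPolynomial.map_X, MvPolynomial.algebraMap_eq, MvPolynomial.map_C]
  refine Finset.sum_congr rfl fun r _ => ?_
  rw [mul_comm]
  simp

theorem map_conj_mem {P : Poly β n k} (hP : P ∈ dyadicIdeal β n k) :
    MvPolynomial.map (starRingEnd ℂ) P ∈ dyadicIdeal β n k := by
  have : dyadicIdeal β n k ≤ (dyadicIdeal β n k).comap (MvPolynomial.map (starRingEnd ℂ)) := by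
    rw [dyadicIdeal, Ideal.span_le]
    rintro _ ⟨⟨p, q⟩, rfl⟩
    change MvPolynomial.map (starRingEnd ℂ) (genericDyadic β n k p q) ∈ dyadicIdeal β n k
    rw [map_conj_genericDyadic]
    exact genericDyadic_mem q p
  exact this hP

end Invariants


/-! ### Integration over the Stiefel manifold -/

section Integration

open Matrix MeasureTheory

variable {β : DysonIndex} {n k : ℕ}

instance (β : DysonIndex) (n : ℕ) : (haar β n).IsHaarMeasure := by
  unfold haar
  infer_instance

instance (β : DysonIndex) (n : ℕ) : IsProbabilityMeasure (haar β n) :=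
  ⟨by simpa [haar] using Measure.haarMeasure_self (K₀ := (⊤ : TopologicalSpace.PositiveCompacts
    (unitaryGp β n)))⟩

/-- A right translate of the Haar measure is again a Haar probability measure, hence the same one.
-/
instance (β : DysonIndex) (n : ℕ) : (haar β n).IsMulRightInvariant where
  map_mul_right_eq_self g := by
    have : IsProbabilityMeasure ((haar β n).map (· * g)) :=
      Measure.isProbabilityMeasure_map (measurable_mul_const g).aemeasurable
    exact Measure.isHaarMeasure_eq_of_isProbabilityMeasure _ _

theorem integral_firstCols_mul_mul {E : Type} [NormedAddCommGroup E] [NormedSpace ℝ E] (hk : k ≤ n)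
    (F : CMat β n k ℂ → E) (g : unitaryGp β n) (h : unitaryGp β k) :
    ∫ U, F (g.1.1 * firstCols β hk U * h.1.1) ∂(haar β n) =
      ∫ U, F (firstCols β hk U) ∂(haar β n) := by
  have e : ∀ U : unitaryGp β n, g.1.1 * firstCols β hk U * h.1.1 =
      firstCols β hk (g * (U * extend hk h)) := by
    intro U
    have : (g * (U * extend hk h)).1.1 = g.1.1 * (U.1.1 * (extend hk h).1.1) := rfl
    rw [firstCols_eq, firstCols_eq, this]
    simp only [Matrix.mul_assoc, extend_mul_incl]
  simp_rw [e]
  rw [integral_mul_right_eq_self (μ := haar β n) (fun U => F (firstCols β hk (g * U))),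
    integral_mul_left_eq_self (μ := haar β n) (fun U => F (firstCols β hk U))]

/-- The element `-1` of the group. -/
noncomputable def negOne (β : DysonIndex) (n : ℕ) : unitaryGp β n :=
  unitaryGp.mk (-1) (InGl.one β n).neg (by simp)

theorem integral_firstCols_neg {E : Type} [NormedAddCommGroup E] [NormedSpace ℝ E] (hk : k ≤ n)
    (F : CMat β n k ℂ → E) :
    ∫ U, F (-firstCols β hk U) ∂(haar β n) = ∫ U, F (firstCols β hk U) ∂(haar β n) := by
  rw [← integral_firstCols_mul_mul hk F (negOne β n) 1]
  have : ∀ U, (negOne β n).1.1 * firstCols β hk U * (1 : unitaryGp β k).1.1 =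
      -firstCols β hk U := fun U => by
    have h1 : (1 : unitaryGp β k).1.1 = 1 := rfl
    have h2 : (negOne β n).1.1 = -1 := rfl
    rw [h1, h2, Matrix.mul_one, Matrix.neg_mul, Matrix.one_mul]
  simp_rw [this]

theorem firstCols_inGl (hk : k ≤ n) (U : unitaryGp β n) : InGl β (firstCols β hk U) := by
  rw [firstCols_eq]
  exact U.2.mul β (incl_inGl hk)

theorem firstCols_conjTranspose_mul (hk : k ≤ n) (U : unitaryGp β n) :
    (firstCols β hk U)ᴴ * firstCols β hk U = 1 := by
  rw [firstCols_eq, Matrix.conjTranspose_mul, Matrix.mul_assoc,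
    ← Matrix.mul_assoc _ (U.1.1 : CMat β n n ℂ), unitaryGp_conjTranspose_mul, Matrix.one_mul,
    incl_conjTranspose_mul]

theorem continuous_coords_firstCols (hk : k ≤ n) (c : Coord β n k) :
    Continuous fun U : unitaryGp β n => coords β (firstCols β hk U) c := by
  have : Continuous fun U : unitaryGp β n => firstCols β hk U := by
    simp_rw [firstCols_eq]
    exact continuous_coe_unitaryGp.matrix_mul continuous_const
  exact (continuous_apply c).comp (continuous_coords.comp this)

theorem integrable_of_continuous {E : Type} [NormedAddCommGroup E] {F : unitaryGp β n → E}
    (hF : Continuous F) : Integrable F (haar β n) :=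
  hF.integrable_of_hasCompactSupport (HasCompactSupport.of_compactSpace _)

/-- The real scalar product of matrices. -/
noncomputable def pairing (B A : CMat β n k ℂ) : ℝ := ∑ c, coords β B c * coords β A c

theorem re_trace_eq_pairing {A B : CMat β n k ℂ} (hA : InGl β A) (hB : InGl β B) :
    (Bᴴ * A).trace.re = gam β * pairing B A := re_trace_toMat hA hB

/-- Cyclicity of the trace: the group actions are orthogonal for the real scalar product. -/
theorem pairing_mul_mul {A B : CMat β n k ℂ} (hA : InGl β A) (hB : InGl β B)
    (g : unitaryGp β n) (h : unitaryGp β k) :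
    pairing (g.1.1 * B * h.1.1) A = pairing B ((g⁻¹).1.1 * A * (h⁻¹).1.1) := by
  have e1 : (g⁻¹).1.1 = (g.1.1 : CMat β n n ℂ)ᴴ := rfl
  have e2 : (h⁻¹).1.1 = (h.1.1 : CMat β k k ℂ)ᴴ := rfl
  have hg : (gam β : ℝ) ≠ 0 := Nat.cast_ne_zero.2 (gam_pos β).ne'
  refine mul_left_cancel₀ hg ?_
  rw [← re_trace_eq_pairing hA ((g.2.mul β hB).mul β h.2),
    ← re_trace_eq_pairing (((g⁻¹).2.mul β hA).mul β (h⁻¹).2) hB, e1, e2,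
    Matrix.conjTranspose_mul, Matrix.mul_assoc, Matrix.trace_mul_comm]
  simp only [Matrix.conjTranspose_mul, Matrix.mul_assoc]

theorem pairing_neg (B A : CMat β n k ℂ) : pairing B (-A) = -pairing B A := by
  have : coords β (-A) = -coords β A := (coordsLM β n k).map_neg A
  simp [pairing, this]

theorem continuous_pairing_firstCols (hk : k ≤ n) (B : CMat β n k ℂ) :
    Continuous fun U : unitaryGp β n => pairing B (firstCols β hk U) :=
  continuous_finsetSum _ fun c _ => continuous_const.mul (continuous_coords_firstCols hk c)

/-- The moments of the coordinates of a random point of the Stiefel manifold. -/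
noncomputable def moment (β : DysonIndex) (hk : k ≤ n) (b : Coord β n k → ℕ) : ℝ :=
  ∫ U, ∏ c, coords β (firstCols β hk U) c ^ b c ∂(haar β n)

/-- The component of degree `2 d` of the generating function of the moments. -/
noncomputable def momentPoly (β : DysonIndex) (hk : k ≤ n) (d : ℕ) : MvPolynomial (Coord β n k) ℝ :=
  ∑ b ∈ Finset.piAntidiag Finset.univ (2 * d), MvPolynomial.monomial (Finsupp.equivFunOnFinite.symm b)
    ((-1) ^ d * (∏ c, ((b c).factorial : ℝ))⁻¹ * moment β hk b)

theorem coeff_momentPoly (hk : k ≤ n) (d : ℕ) (b : Coord β n k →₀ ℕ) (hb : b.degree = 2 * d) :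
    (momentPoly β hk d).coeff b =
      (-1) ^ d * (∏ c, ((b c).factorial : ℝ))⁻¹ * moment β hk b := by
  classical
  rw [momentPoly, MvPolynomial.coeff_sum, Finset.sum_eq_single (b : Coord β n k → ℕ)]
  · rw [MvPolynomial.coeff_monomial, if_pos (by simp)]
  · intro b' _ hb'
    rw [MvPolynomial.coeff_monomial, if_neg]
    rintro rfl
    exact hb' (by simp)
  · intro h
    exact absurd (by simpa [Finset.mem_piAntidiag, Finsupp.degree_eq_sum] using hb) h

theorem isHomogeneous_momentPoly (hk : k ≤ n) (d : ℕ) :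
    (momentPoly β hk d).IsHomogeneous (2 * d) := by
  refine MvPolynomial.IsHomogeneous.sum _ _ _ fun b hb => MvPolynomial.isHomogeneous_monomial _ ?_
  rw [Finset.mem_piAntidiag] at hb
  simpa [Finsupp.degree_eq_sum] using hb.1

/-- Multinomial theorem: the multinomial coefficient over (2d)! is 1/∏ b_c!. The right side is the
averaged Taylor term of cos⟨B, A⟩. -/
theorem eval_momentPoly (hk : k ≤ n) (d : ℕ) (B : CMat β n k ℂ) :
    MvPolynomial.eval (coords β B) (momentPoly β hk d) =
      ∫ U, (-1) ^ d * pairing B (firstCols β hk U) ^ (2 * d) / (2 * d).factorial ∂(haar β n) := by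
  rw [momentPoly, map_sum]
  simp_rw [pairing, Finset.sum_pow_eq_sum_piAntidiag, Finset.mul_sum, Finset.sum_div]
  rw [integral_finsetSum]
  · refine Finset.sum_congr rfl fun b hb => ?_
    rw [Finset.mem_piAntidiag] at hb
    have hm := Nat.multinomial_spec Finset.univ b
    rw [hb.1] at hm
    have hm' : ((Nat.multinomial Finset.univ b : ℕ) : ℝ) / (2 * d).factorial =
        (∏ c, ((b c).factorial : ℝ))⁻¹ := by
      have h1 : (∏ c, ((b c).factorial : ℝ)) ≠ 0 :=
        Finset.prod_ne_zero_iff.2 fun c _ => Nat.cast_ne_zero.2 (Nat.factorial_ne_zero _)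
      have h2 : ((2 * d).factorial : ℝ) ≠ 0 := Nat.cast_ne_zero.2 (Nat.factorial_ne_zero _)
      rw [div_eq_iff h2, eq_inv_mul_iff_mul_eq₀ h1]
      exact_mod_cast hm
    rw [MvPolynomial.eval_monomial, Finsupp.prod_fintype _ _ (by simp), ← hm', moment]
    simp only [Finsupp.equivFunOnFinite_symm_apply_apply, mul_pow, Finset.prod_mul_distrib]
    rw [mul_right_comm, ← integral_const_mul]
    refine integral_congr_ae (Filter.Eventually.of_forall fun U => ?_)
    simp only
    ring
  · intro b _
    refine integrable_of_continuous ?_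
    refine (continuous_const.mul (continuous_const.mul (continuous_finsetProd _ fun c _ =>
      (continuous_const.mul (continuous_coords_firstCols hk c)).pow _))).div_const _

theorem eval_momentPoly_mul_mul (hk : k ≤ n) (d : ℕ) {B : CMat β n k ℂ} (hB : InGl β B)
    (g : unitaryGp β n) (h : unitaryGp β k) :
    MvPolynomial.eval (coords β (g.1.1 * B * h.1.1)) (momentPoly β hk d) =
      MvPolynomial.eval (coords β B) (momentPoly β hk d) := by
  rw [eval_momentPoly, eval_momentPoly,
    ← integral_firstCols_mul_mul hk (fun A => (-1) ^ d * pairing B A ^ (2 * d) / (2 * d).factorial)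
      g⁻¹ h⁻¹]
  simp_rw [pairing_mul_mul (firstCols_inGl hk _) hB]

/-- The sine part is odd under A ↦ -A and integrates to zero; this also makes the series real. -/
theorem psiHat_eq (hk : k ≤ n) {B : CMat β n k ℂ} (hB : InGl β B) :
    psiHat β hk B = ((∫ U, Real.cos (pairing B (firstCols β hk U)) ∂(haar β n) : ℝ) : ℂ) := by
  have h1 : ∀ U : unitaryGp β n, Complex.exp (Complex.I * ((Bᴴ * firstCols β hk U).trace +
      ((firstCols β hk U)ᴴ * B).trace) / (2 * gam β)) =
      ((Real.cos (pairing B (firstCols β hk U)) : ℝ) : ℂ) +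
        ((Real.sin (pairing B (firstCols β hk U)) : ℝ) : ℂ) * Complex.I := by
    intro U
    rw [trace_add_trace (firstCols_inGl hk U) hB]
    have hg : (2 * gam β : ℂ) ≠ 0 :=
      mul_ne_zero two_ne_zero (Nat.cast_ne_zero.2 (gam_pos β).ne')
    rw [mul_left_comm, mul_div_cancel_left₀ _ hg, Complex.ofReal_cos, Complex.ofReal_sin,
      ← Complex.exp_mul_I, mul_comm, pairing]
    push_cast
    rfl
  have h2 : ∫ U, Real.sin (pairing B (firstCols β hk U)) ∂(haar β n) = 0 := by
    have := integral_firstCols_neg hk (fun A => Real.sin (pairing B A))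
    simp only [pairing_neg, Real.sin_neg, integral_neg] at this
    linarith
  have hc := continuous_pairing_firstCols hk B
  rw [psiHat, stiefelIntegral]
  simp_rw [h1]
  rw [integral_add, integral_mul_const, integral_complex_ofReal, integral_complex_ofReal, h2]
  · simp
  · exact integrable_of_continuous (Complex.continuous_ofReal.comp (Real.continuous_cos.comp hc))
  · exact (integrable_of_continuous
      (Complex.continuous_ofReal.comp (Real.continuous_sin.comp hc))).mul_const _

/-- The pairing is bounded by some M on the compact group, so M^(2d)/(2d)! allows the sum and the
integral to be exchanged. -/
theorem hasSum_psiHat (hk : k ≤ n) {B : CMat β n k ℂ} (hB : InGl β B) :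
    HasSum (fun d : ℕ => ((MvPolynomial.eval (coords β B) (momentPoly β hk d) : ℝ) : ℂ))
      (psiHat β hk B) := by
  rw [psiHat_eq hk hB, Complex.hasSum_ofReal]
  simp_rw [eval_momentPoly]
  have hc := continuous_pairing_firstCols hk B
  obtain ⟨M, hM⟩ := (isCompact_range hc).isBounded.exists_norm_le
  have hM' : ∀ U : unitaryGp β n, |pairing B (firstCols β hk U)| ≤ M := fun U =>
    hM _ (Set.mem_range_self U)
  have hint : ∀ d : ℕ, Integrable (fun U : unitaryGp β n =>
      (-1 : ℝ) ^ d * pairing B (firstCols β hk U) ^ (2 * d) / (2 * d).factorial) (haar β n) :=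
    fun d => integrable_of_continuous ((continuous_const.mul (hc.pow _)).div_const _)
  have hsum : Summable fun d : ℕ => ∫ U, ‖(-1 : ℝ) ^ d * pairing B (firstCols β hk U) ^ (2 * d) /
      (2 * d).factorial‖ ∂(haar β n) := by
    refine Summable.of_nonneg_of_le (fun d => integral_nonneg fun U => norm_nonneg _) (fun d => ?_)
      ((Real.summable_pow_div_factorial M).comp_injective
        (i := fun d : ℕ => 2 * d) (fun a b h => by simpa using h))
    have : ∫ _U : unitaryGp β n, M ^ (2 * d) / ((2 * d).factorial : ℝ) ∂(haar β n) =
        M ^ (2 * d) / ((2 * d).factorial : ℝ) := by simp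
    simp only [Function.comp]
    rw [← this]
    refine integral_mono (hint d).norm (integrable_const _) fun U => ?_
    simp only [norm_div, norm_mul, norm_pow, norm_neg, norm_one, one_pow, one_mul, Real.norm_eq_abs,
      Nat.abs_cast]
    gcongr
    exact hM' U
  have := hasSum_integral_of_summable_integral_norm hint hsum
  simp_rw [(Real.hasSum_cos _).tsum_eq] at this
  exact this

theorem integral_eval_eq_sum (hk : k ≤ n) (f : Poly β n k) :
    stiefelIntegral β hk (fun A => MvPolynomial.eval (fun c => (coords β A c : ℂ)) f) =
      ∑ b ∈ f.support, f.coeff b * (moment β hk b : ℂ) := by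
  rw [stiefelIntegral]
  simp_rw [MvPolynomial.eval_eq']
  rw [integral_finsetSum]
  · refine Finset.sum_congr rfl fun b _ => ?_
    rw [integral_const_mul, moment, ← integral_complex_ofReal]
    simp
  · intro b _
    refine (integrable_of_continuous ?_).const_mul _
    exact continuous_finsetProd _ fun c _ =>
      (Complex.continuous_ofReal.comp (continuous_coords_firstCols hk c)).pow _

/-- The Pizzetti formula in degree 2d: the weight i^(2d) b! cancels the factor (-1)^d / b! and
leaves the moments. -/
theorem fischer_momentPoly (hk : k ≤ n) {d : ℕ} {f : Poly β n k} (hf : f.IsHomogeneous (2 * d)) :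
    fischer ((momentPoly β hk d).map Complex.ofRealHom) f =
      stiefelIntegral β hk (fun A => MvPolynomial.eval (fun c => (coords β A c : ℂ)) f) := by
  rw [integral_eval_eq_sum, fischer_eq_sum]
  refine Finset.sum_congr rfl fun b hb => ?_
  have hb' : b.degree = 2 * d := by
    by_contra hne
    exact MvPolynomial.mem_support_iff.1 hb (hf.coeff_eq_zero hne)
  rw [MvPolynomial.coeff_map, coeff_momentPoly hk d b hb', fischerWeight_eq, hb', pow_mul,
    Complex.I_sq]
  have h1 : (∏ c, ((b c).factorial : ℂ)) ≠ 0 :=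
    Finset.prod_ne_zero_iff.2 fun c _ => Nat.cast_ne_zero.2 (Nat.factorial_ne_zero _)
  have h2 : (-1 : ℂ) ^ d * (-1) ^ d = 1 := by rw [← mul_pow]; simp
  simp only [Complex.ofRealHom_eq_coe]
  push_cast
  field_simp
  linear_combination (f.coeff b * (moment β hk b : ℂ)) * h2

theorem moment_of_odd (hk : k ≤ n) {b : Coord β n k →₀ ℕ} (hb : Odd b.degree) :
    moment β hk b = 0 := by
  have h := integral_firstCols_neg hk (fun A : CMat β n k ℂ => ∏ c, coords β A c ^ b c)
  have h1 : ∀ A : CMat β n k ℂ, ∏ c, coords β (-A) c ^ b c = -∏ c, coords β A c ^ b c := by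
    intro A
    have : coords β (-A) = -coords β A := (coordsLM β n k).map_neg A
    simp_rw [this, Pi.neg_apply, neg_pow (coords β A _)]
    rw [Finset.prod_mul_distrib, Finset.prod_pow_eq_pow_sum, ← Finsupp.degree_eq_sum, hb.neg_one_pow]
    ring
  simp_rw [h1, integral_neg] at h
  rw [moment]
  linarith

theorem integral_eval_of_odd (hk : k ≤ n) {m : ℕ} (hm : Odd m) {f : Poly β n k}
    (hf : f.IsHomogeneous m) :
    stiefelIntegral β hk (fun A => MvPolynomial.eval (fun c => (coords β A c : ℂ)) f) = 0 := by
  rw [integral_eval_eq_sum]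
  refine Finset.sum_eq_zero fun b hb => ?_
  have hb' : b.degree = m := by
    by_contra hne
    exact MvPolynomial.mem_support_iff.1 hb (hf.coeff_eq_zero hne)
  rw [moment_of_odd hk (hb' ▸ hm)]
  simp

end Integration


/-! ### Formal power series in the invariants -/

section Components

open Matrix

variable {β : DysonIndex} {n k : ℕ}

/-- The monomial `I^a` in the invariants. -/
noncomputable def invMonomial (β : DysonIndex) (n k : ℕ) (a : Fin k →₀ ℕ) : Poly β n k :=
  ∏ j, invariantPoly β n k j ^ a j

/-- The component of `φ(I_1, …, I_k)` which is homogeneous of degree `2 d`. -/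
noncomputable def component (β : DysonIndex) (n k : ℕ) (φ : MvPowerSeries (Fin k) ℝ) (d : ℕ) :
    Poly β n k :=
  ∑ a ∈ multiIndices k d, MvPolynomial.C ((MvPowerSeries.coeff a φ : ℝ) : ℂ) * invMonomial β n k a

theorem isHomogeneous_invMonomial (a : Fin k →₀ ℕ) :
    (invMonomial β n k a).IsHomogeneous (2 * ∑ j : Fin k, ((j : ℕ) + 1) * a j) := by
  have : 2 * ∑ j : Fin k, ((j : ℕ) + 1) * a j = ∑ j : Fin k, 2 * ((j : ℕ) + 1) * a j := by
    rw [Finset.mul_sum]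
    exact Finset.sum_congr rfl fun j _ => by ring
  rw [this]
  exact MvPolynomial.IsHomogeneous.prod _ _ _ fun j _ => (isHomogeneous_invariantPoly j).pow (a j)

theorem isHomogeneous_component (φ : MvPowerSeries (Fin k) ℝ) (d : ℕ) :
    (component β n k φ d).IsHomogeneous (2 * d) := by
  refine MvPolynomial.IsHomogeneous.sum _ _ _ fun a ha => ?_
  have := (MvPolynomial.isHomogeneous_C (Coord β n k) ((MvPowerSeries.coeff a φ : ℝ) : ℂ)).mul
    (isHomogeneous_invMonomial (β := β) (n := n) a)
  rwa [mem_multiIndices.1 ha, zero_add] at this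

theorem eval_component {B : CMat β n k ℂ} (hB : InGl β B) (φ : MvPowerSeries (Fin k) ℝ) (d : ℕ) :
    MvPolynomial.eval (fun c => (coords β B c : ℂ)) (component β n k φ d) =
      ∑ a ∈ multiIndices k d, ((MvPowerSeries.coeff a φ : ℝ) : ℂ) * ∏ j, invVal B j ^ a j := by
  simp [component, invMonomial, eval_coords_invariantPoly hB]

theorem eval_component_smul {B : CMat β n k ℂ} (hB : InGl β B) (φ : MvPowerSeries (Fin k) ℝ) (d : ℕ)
    (t : ℝ) :
    MvPolynomial.eval (fun c => (coords β (t • B) c : ℂ)) (component β n k φ d) =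
      ((t ^ 2 : ℝ) : ℂ) ^ d *
        MvPolynomial.eval (fun c => (coords β B c : ℂ)) (component β n k φ d) := by
  rw [eval_component hB, eval_component (hB.real_smul t), Finset.mul_sum]
  refine Finset.sum_congr rfl fun a ha => ?_
  simp_rw [invVal_real_smul, mul_pow, Finset.prod_mul_distrib, ← pow_mul]
  rw [Finset.prod_pow_eq_pow_sum, mem_multiIndices.1 ha]
  ring

theorem ext_inGl {P Q : Poly β n k} (h : ∀ B : CMat β n k ℂ, InGl β B →
    MvPolynomial.eval (fun c => (coords β B c : ℂ)) P =
      MvPolynomial.eval (fun c => (coords β B c : ℂ)) Q) : P = Q :=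
  ext_real fun x => by simpa only [coords_toMat] using h _ (inGl_toMat x)

/-- On rectangular diagonal matrices, available because k ≤ n, the I_j are the elementary symmetric
polynomials of the squares s_j², and these are algebraically independent. -/
theorem eq_of_component_eq (hk : k ≤ n) {φ ψ : MvPowerSeries (Fin k) ℝ}
    (h : ∀ d, component β n k φ d = component β n k ψ d) : φ = ψ := by
  classical
  ext a
  set d := ∑ j : Fin k, ((j : ℕ) + 1) * a j with hd
  set Q : MvPolynomial (Fin k) ℂ := ∑ a ∈ multiIndices k d, MvPolynomial.monomial a
    (((MvPowerSeries.coeff a φ - MvPowerSeries.coeff a ψ : ℝ)) : ℂ) with hQ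
  have hQ0 : MvPolynomial.esymmAlgHom (Fin k) ℂ k Q = 0 := by
    apply Subtype.ext
    rw [MvPolynomial.esymmAlgHom_apply]
    refine MvPolynomial.funext_set (fun _ => Set.range fun s : ℕ => (((s : ℝ) ^ 2 : ℝ) : ℂ))
      (fun _ => Set.infinite_range_of_injective fun a b hab => ?_) fun x hx => ?_
    · have : (a : ℝ) ^ 2 = (b : ℝ) ^ 2 := Complex.ofReal_injective hab
      have : a ^ 2 = b ^ 2 := by exact_mod_cast this
      exact Nat.pow_left_injective two_ne_zero this
    · choose s hs using fun j => hx j (Set.mem_univ j)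
      obtain rfl : (fun j => (((s j : ℝ) ^ 2 : ℝ) : ℂ)) = x := funext hs
      have h1 := congrArg (MvPolynomial.eval fun c =>
        (coords β (diagMat β hk fun j => (s j : ℝ)) c : ℂ)) (h d)
      rw [eval_component (diagMat_inGl _ _), eval_component (diagMat_inGl _ _), ← sub_eq_zero,
        ← Finset.sum_sub_distrib] at h1
      simp only [invVal_diagMat] at h1
      rw [hQ, map_sum, map_sum]
      simp only [MvPolynomial.aeval_monomial, map_mul, MvPolynomial.algebraMap_eq,
        MvPolynomial.eval_C, ZeroMemClass.coe_zero, map_zero]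
      rw [← h1]
      refine Finset.sum_congr rfl fun b _ => ?_
      rw [Finsupp.prod_fintype _ _ (by simp), map_prod]
      simp only [map_pow]
      push_cast
      ring
  have hQ1 : Q = 0 :=
    (MvPolynomial.esymmAlgHom_fin_bijective ℂ k).1 (hQ0.trans (map_zero _).symm)
  have h2 := congrArg (MvPolynomial.coeff a) hQ1
  rw [hQ, MvPolynomial.coeff_sum, Finset.sum_eq_single a] at h2
  · rw [MvPolynomial.coeff_monomial, if_pos rfl, MvPolynomial.coeff_zero, Complex.ofReal_eq_zero,
      sub_eq_zero] at h2
    exact h2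
  · intro b _ hb
    rw [MvPolynomial.coeff_monomial, if_neg hb]
  · intro ha
    exact absurd (mem_multiIndices.2 hd.symm) ha

theorem component_zero (φ : MvPowerSeries (Fin k) ℝ) :
    component β n k φ 0 = MvPolynomial.C ((MvPowerSeries.constantCoeff φ : ℝ) : ℂ) := by
  have : multiIndices k 0 = {0} := by
    ext a
    rw [mem_multiIndices, Finset.mem_singleton]
    simp [Finsupp.ext_iff]
  rw [component, this, Finset.sum_singleton]
  simp [invMonomial]

theorem component_succ_mem (φ : MvPowerSeries (Fin k) ℝ) (d : ℕ) :
    component β n k φ (d + 1) ∈ dyadicIdeal β n k := by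
  refine Ideal.sum_mem _ fun a ha => Ideal.mul_mem_left _ _ ?_
  have : ∃ j, a j ≠ 0 := by
    by_contra! h0
    have := mem_multiIndices.1 ha
    simp [h0] at this
  obtain ⟨j, hj⟩ := this
  rw [invMonomial, ← Finset.mul_prod_erase _ _ (Finset.mem_univ j)]
  exact Ideal.mul_mem_right _ _ (Ideal.pow_mem_of_mem _ (invariantPoly_mem j) _ (Nat.pos_of_ne_zero hj))

/-- Reduces the `finsum` to a finite sum over weights: a monomial of weight at least N has degree at
least 2N, beyond the degree of f. -/
theorem applySeries_eq_sum (φ : MvPowerSeries (Fin k) ℝ) (f : Poly β n k) {N : ℕ}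
    (hN : f.totalDegree < N) :
    applySeries β n k φ f = ∑ d ∈ Finset.range N, fischer (component β n k φ d) f := by
  classical
  have h1 : ∀ d, fischer (component β n k φ d) f = ∑ a ∈ multiIndices k d,
      ((MvPowerSeries.coeff a φ : ℝ) : ℂ) * fischer (invMonomial β n k a) f := by
    intro d
    simp [component, ← MvPolynomial.smul_eq_C_mul, LinearMap.sum_apply]
  have hd : (↑(Finset.range N) : Set ℕ).PairwiseDisjoint (multiIndices k) := by
    intro d _ e _ hde
    rw [Function.onFun, Finset.disjoint_left]
    intro a ha ha'
    exact hde ((mem_multiIndices.1 ha).symm.trans (mem_multiIndices.1 ha'))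
  simp_rw [h1]
  rw [← Finset.sum_biUnion hd]
  refine finsum_eq_sum_of_support_subset _ fun a ha => ?_
  by_contra hna
  apply ha
  have hw : N ≤ ∑ j : Fin k, ((j : ℕ) + 1) * a j := by
    by_contra! hlt
    exact hna (Finset.mem_coe.2 (Finset.mem_biUnion.2 ⟨_, Finset.mem_range.2 hlt,
      mem_multiIndices.2 rfl⟩))
  have h0 : fischer (invMonomial β n k a) f = 0 := by
    rw [fischer_eq_sum]
    refine Finset.sum_eq_zero fun b hb => ?_
    have hb' := MvPolynomial.le_totalDegree hb
    rw [(isHomogeneous_invMonomial a).coeff_eq_zero]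
    · simp
    · have : b.degree ≤ f.totalDegree := hb'
      omega
  exact mul_eq_zero_of_right _ h0

theorem applySeries_add (φ : MvPowerSeries (Fin k) ℝ) (f g : Poly β n k) :
    applySeries β n k φ (f + g) = applySeries β n k φ f + applySeries β n k φ g := by
  set N := max f.totalDegree g.totalDegree + 1
  have hf : f.totalDegree < N := Nat.lt_succ_of_le (le_max_left _ _)
  have hg : g.totalDegree < N := Nat.lt_succ_of_le (le_max_right _ _)
  have hfg : (f + g).totalDegree < N :=
    Nat.lt_succ_of_le (MvPolynomial.totalDegree_add _ _)
  rw [applySeries_eq_sum φ _ hf, applySeries_eq_sum φ _ hg, applySeries_eq_sum φ _ hfg,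
    ← Finset.sum_add_distrib]
  simp

theorem applySeries_of_even (φ : MvPowerSeries (Fin k) ℝ) {f : Poly β n k} {d : ℕ}
    (hf : f.IsHomogeneous (2 * d)) :
    applySeries β n k φ f = fischer (component β n k φ d) f := by
  have hN : f.totalDegree < 2 * d + 1 := Nat.lt_succ_of_le hf.totalDegree_le
  rw [applySeries_eq_sum φ f hN, Finset.sum_eq_single d]
  · intro e _ he
    exact fischer_of_isHomogeneous (isHomogeneous_component φ e) hf (by omega)
  · intro h
    exact absurd (Finset.mem_range.2 (by omega)) h

theorem applySeries_of_odd (φ : MvPowerSeries (Fin k) ℝ) {f : Poly β n k} {m : ℕ} (hm : Odd m)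
    (hf : f.IsHomogeneous m) : applySeries β n k φ f = 0 := by
  rw [applySeries_eq_sum φ f (Nat.lt_succ_self _)]
  refine Finset.sum_eq_zero fun e _ =>
    fischer_of_isHomogeneous (isHomogeneous_component φ e) hf ?_
  rintro rfl
  exact absurd hm (by simp)

theorem component_eq_of_applySeries_eq {φ ψ : MvPowerSeries (Fin k) ℝ}
    (h : ∀ f : Poly β n k, applySeries β n k φ f = applySeries β n k ψ f) (d : ℕ) :
    component β n k φ d = component β n k ψ d := by
  rw [← sub_eq_zero]
  refine eq_zero_of_fischer_homogeneous
    ((isHomogeneous_component φ d).sub (isHomogeneous_component ψ d)) fun f hf => ?_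
  rw [map_sub, LinearMap.sub_apply, ← applySeries_of_even φ hf, ← applySeries_of_even ψ hf, h,
    sub_self]

/-! ### The action of the right group on polynomials -/

/-- The matrix of the right multiplication by `h` in real coordinates. -/
noncomputable def rightMulMatrix (n : ℕ) (h : unitaryGp β k) :
    Matrix (Coord β n k) (Coord β n k) ℝ :=
  LinearMap.toMatrix' ((coordsLM β n k).comp
    (({ toFun := fun A => A * h.1.1
        map_add' := fun A B => Matrix.add_mul A B _
        map_smul' := fun r A => Matrix.smul_mul r A _ } : CMat β n k ℂ →ₗ[ℝ] CMat β n k ℂ).comp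
      (toMatLM β n k)))

theorem rightMulMatrix_mulVec (h : unitaryGp β k) (x : Coord β n k → ℝ) :
    rightMulMatrix n h *ᵥ x = coords β (toMat β x * h.1.1) :=
  LinearMap.toMatrix'_mulVec _ _

/-- Orthogonality is the invariance of the real scalar product under right multiplication, tested on
unit vectors. -/
theorem rightMulMatrix_transpose_mul (h : unitaryGp β k) :
    (rightMulMatrix n h)ᵀ * rightMulMatrix n h = 1 := by
  have h1 : ∀ x y : Coord β n k → ℝ,
      (rightMulMatrix n h *ᵥ x) ⬝ᵥ (rightMulMatrix n h *ᵥ y) = x ⬝ᵥ y := by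
    intro x y
    rw [rightMulMatrix_mulVec, rightMulMatrix_mulVec]
    have := pairing_mul_mul ((inGl_toMat y).mul β h.2) (inGl_toMat x) (1 : unitaryGp β n) h
    have e1 : ((1 : unitaryGp β n)⁻¹).1.1 = 1 := by simp
    have e2 : (h⁻¹).1.1 = (h.1.1 : CMat β k k ℂ)ᴴ := rfl
    have e3 : (1 : unitaryGp β n).1.1 = 1 := rfl
    rw [e1, e2, e3, Matrix.one_mul, Matrix.one_mul, Matrix.mul_assoc _ (h.1.1 : CMat β k k ℂ),
      unitaryGp_mul_conjTranspose, Matrix.mul_one] at this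
    simpa only [pairing, coords_toMat, dotProduct] using this
  ext c d
  have := h1 (Pi.single c 1) (Pi.single d 1)
  rw [Matrix.mulVec_single_one, Matrix.mulVec_single_one] at this
  rw [Matrix.mul_apply, Matrix.one_apply]
  simpa [dotProduct, Pi.single_apply, Matrix.col, eq_comm] using this

theorem rightMulMatrix_mul_transpose (h : unitaryGp β k) :
    rightMulMatrix n h * (rightMulMatrix n h)ᵀ = 1 :=
  mul_eq_one_comm.1 (rightMulMatrix_transpose_mul h)

theorem eval_linSubst_real {σ : Type} [Fintype σ] (T : Matrix σ σ ℝ) (x : σ → ℝ)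
    (f : MvPolynomial σ ℂ) : MvPolynomial.eval (fun c => (x c : ℂ)) (linSubst T f) =
      MvPolynomial.eval (fun c => ((T *ᵥ x) c : ℂ)) f := by
  rw [eval_linSubst]
  simp [Matrix.mulVec, dotProduct]

theorem linSubst_linSubst_transpose {σ : Type} [Fintype σ] [DecidableEq σ] {T : Matrix σ σ ℝ}
    (hT : Tᵀ * T = 1) (f : MvPolynomial σ ℂ) : linSubst T (linSubst Tᵀ f) = f :=
  ext_real fun x => by
    rw [eval_linSubst_real, eval_linSubst_real, Matrix.mulVec_mulVec, hT, Matrix.one_mulVec]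

theorem linSubst_invariantPoly (h : unitaryGp β k) (j : Fin k) :
    linSubst (rightMulMatrix n h) (invariantPoly β n k j) = invariantPoly β n k j :=
  ext_real fun x => by
    rw [eval_linSubst_real, rightMulMatrix_mulVec,
      eval_coords_invariantPoly ((inGl_toMat x).mul β h.2), eval_invariantPoly]
    have := invVal_mul_mul (1 : unitaryGp β n) h (toMat β x)
    have e3 : (1 : unitaryGp β n).1.1 = 1 := rfl
    rw [e3, Matrix.one_mul] at this
    rw [this]

theorem linSubst_component (h : unitaryGp β k) (φ : MvPowerSeries (Fin k) ℝ) (d : ℕ) :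
    linSubst (rightMulMatrix n h) (component β n k φ d) = component β n k φ d := by
  have hC : ∀ r : ℂ, linSubst (rightMulMatrix n h) (MvPolynomial.C r) = MvPolynomial.C r :=
    fun r => (linSubst (rightMulMatrix n h)).commutes r
  simp only [component, invMonomial, map_sum, map_mul, map_prod, map_pow, linSubst_invariantPoly, hC]

theorem linSubst_genericDyadic (h : unitaryGp β k) (p q) :
    linSubst (rightMulMatrix n h) (genericDyadic β n k p q) =
      ∑ p', ∑ q', (star (h.1.1 p' p) * h.1.1 q' q) • genericDyadic β n k p' q' := by
  refine ext_real fun x => ?_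
  have e : ∀ (y : Coord β n k → ℝ) p q, MvPolynomial.eval (fun c => (y c : ℂ))
      (genericDyadic β n k p q) = ((toMat β y)ᴴ * toMat β y) p q := fun y p q =>
    congrFun (congrFun (genericDyadic_map_eval y) p) q
  rw [eval_linSubst_real, rightMulMatrix_mulVec, e, toMat_coords ((inGl_toMat x).mul β h.2)]
  simp only [map_sum, MvPolynomial.smul_eval, e]
  rw [Matrix.conjTranspose_mul, ← Matrix.mul_assoc, Matrix.mul_assoc _ _ (toMat β x)]
  generalize (toMat β x)ᴴ * toMat β x = G
  simp only [Matrix.mul_apply, Finset.sum_mul, Matrix.conjTranspose_apply]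
  rw [Finset.sum_comm]
  exact Finset.sum_congr rfl fun p' _ => Finset.sum_congr rfl fun q' _ => by ring

/-! ### From the single entry u² to all entries of X†X. -/

theorem incl_conjTranspose_mul_apply {R : Type} [Fintype R] (hk : k ≤ n)
    (X : Matrix (Fin n × Fin (gam β)) R ℂ) (p) (q : R) :
    ((incl β hk)ᴴ * X) p q = X (Fin.castLE hk p.1, p.2) q := by
  have := mul_incl_apply hk Xᴴ q p
  rw [← star_inj, ← Matrix.conjTranspose_apply, Matrix.conjTranspose_mul,
    Matrix.conjTranspose_conjTranspose, this, Matrix.conjTranspose_apply]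

/-- Every vector is a real multiple of the first column of a group element, and the scalar enters as
r². -/
theorem conjTranspose_mul_mul_apply_eq_zero (hk : 0 < k) {m : CMat β k k ℂ}
    (hm : ∀ h : unitaryGp β k, ((h.1.1 : CMat β k k ℂ)ᴴ * m * h.1.1)
      (⟨0, hk⟩, ⟨0, gam_pos β⟩) (⟨0, hk⟩, ⟨0, gam_pos β⟩) = 0)
    (v : CMat β k 1 ℂ) (hv : InGl β v) :
    (vᴴ * m * v) (0, ⟨0, gam_pos β⟩) (0, ⟨0, gam_pos β⟩) = 0 := by
  obtain ⟨g, r, rfl⟩ := exists_eq_smul_mul v hv hk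
  have e : (r • (g.1.1 * incl β hk))ᴴ * m * (r • (g.1.1 * incl β hk)) =
      (r * r) • ((incl β hk)ᴴ * ((g.1.1 : CMat β k k ℂ)ᴴ * m * g.1.1 * incl β hk)) := by
    simp only [Matrix.conjTranspose_smul, star_trivial, Matrix.conjTranspose_mul, Matrix.smul_mul,
      Matrix.mul_smul, smul_smul, Matrix.mul_assoc]
  have e0 : Fin.castLE (show 1 ≤ k from hk) 0 = ⟨0, hk⟩ := rfl
  have h0 := hm g
  rw [e, Matrix.smul_apply, incl_conjTranspose_mul_apply, mul_incl_apply]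
  simp only [e0]
  rw [h0, smul_zero]

theorem quadratic_eq_zero (hk : 0 < k) {m : CMat β k k ℂ}
    (hm : ∀ h : unitaryGp β k, ((h.1.1 : CMat β k k ℂ)ᴴ * m * h.1.1)
      (⟨0, hk⟩, ⟨0, gam_pos β⟩) (⟨0, hk⟩, ⟨0, gam_pos β⟩) = 0)
    (w : Fin k × Fin (gam β) → ℂ) (hw : β = .one → ∀ p, star (w p) = w p) :
    star w ⬝ᵥ (m *ᵥ w) = 0 := by
  have key : ∀ v : CMat β k 1 ℂ, InGl β v → (∀ p, v p (0, ⟨0, gam_pos β⟩) = w p) →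
      star w ⬝ᵥ (m *ᵥ w) = 0 := by
    intro v hv hvw
    rw [← conjTranspose_mul_mul_apply_eq_zero hk hm v hv, Matrix.mul_assoc]
    simp only [dotProduct, Matrix.mul_apply, Matrix.mulVec, Matrix.conjTranspose_apply, hvw,
      Pi.star_apply]
  cases β
  · refine key (Matrix.of fun p _ => w p) ?_ fun p => rfl
    simp only [InGl]
    ext p q
    exact hw rfl p
  · exact key (Matrix.of fun p _ => w p) trivial fun p => rfl
  -- A complex vector is the first column of a quaternionic one; the quaternionic condition forces
  -- the second column.
  · refine key (Matrix.of fun p q => if q.2 = 0 then w p else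
      if p.2 = 0 then -star (w (p.1, 1)) else star (w (p.1, 0))) ?_ fun p => rfl
    rw [inGl_four_iff]
    intro i j
    simp

/-- Polarisation with the vectors e_p + y e_q for y = 0, 1, i. Over ℝ the choice y = i is not
available, and symmetry of m replaces it. -/
theorem eq_zero_of_conj_apply_eq_zero (hk : 0 < k) {m : CMat β k k ℂ}
    (hm : ∀ h : unitaryGp β k, ((h.1.1 : CMat β k k ℂ)ᴴ * m * h.1.1)
      (⟨0, hk⟩, ⟨0, gam_pos β⟩) (⟨0, hk⟩, ⟨0, gam_pos β⟩) = 0)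
    (hs : β = .one → ∀ p q, m p q = m q p) : m = 0 := by
  have hq : ∀ p q (y : ℂ), (β = .one → star y = y) →
      m p p + star y * m q p + y * m p q + star y * y * m q q = 0 := by
    intro p q y hy
    have := quadratic_eq_zero hk hm (Pi.single p 1 + Pi.single q y) (fun hβ r => by
      simp only [Pi.add_apply, Pi.single_apply]
      split_ifs <;> simp_all)
    have h1 : star (Pi.single p 1 + Pi.single q y : Fin k × Fin (gam β) → ℂ) =
        Pi.single p 1 + Pi.single q (star y) := by
      rw [star_add, ← Pi.single_star, ← Pi.single_star, star_one]
    rw [h1] at this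
    simp only [Matrix.mulVec_add, dotProduct_add, add_dotProduct, single_dotProduct, one_mul,
      Matrix.mulVec_single, Matrix.col_apply, Pi.smul_apply, MulOpposite.smul_eq_mul_unop,
      MulOpposite.unop_op, mul_one] at this
    linear_combination this
  have hd : ∀ p, m p p = 0 := fun p => by simpa using hq p p 0 (by simp)
  ext p q
  have h1 := hq p q 1 (by simp)
  rw [hd, hd] at h1
  by_cases hβ : β = .one
  · rw [hs hβ q p] at h1
    simp only [star_one, one_mul, mul_zero, zero_add, add_zero] at h1
    simpa using h1
  · have h2 := hq p q Complex.I (fun h => absurd h hβ)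
    rw [hd, hd] at h2
    simp only [Complex.star_def, Complex.conj_I, one_mul, mul_zero, zero_add,
      add_zero, star_one] at h1 h2
    have h3 : m p q = 0 := by
      have : Complex.I * (m p q - m q p) = 0 := by linear_combination h2
      have := (mul_eq_zero.1 this).resolve_left Complex.I_ne_zero
      linear_combination (h1 + this) / 2
    simpa using h3

theorem genericDyadic_comm_of_real (hβ : β = .one) (p q) :
    genericDyadic β n k p q = genericDyadic β n k q p := by
  subst hβ
  rw [genericDyadic_apply, genericDyadic_apply]
  refine Finset.sum_congr rfl fun r _ => ?_
  rw [mul_comm]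
  simp [adjOfCoords, ofCoords, basisMat, Matrix.one_apply, eq_comm]

/-- Invariance of E and of the pairing moves the rotation onto u², giving (h†Mh)₁₁ = 0 for the
matrix M of pairings of E with (X†X)_pq f, so M = 0. Then E is orthogonal to the whole ideal, in
particular to its own conjugate. -/
theorem eq_zero_of_fischer_uSq (hk : 0 < k) {E : Poly β n k} {m : ℕ} (hE : E.IsHomogeneous m)
    (hmem : E ∈ dyadicIdeal β n k)
    (hinv : ∀ h : unitaryGp β k, linSubst (rightMulMatrix n h) E = E)
    (hu : ∀ f, fischer E (uSq β n k hk * f) = 0) : E = 0 := by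
  have h1 : ∀ f p q, fischer E (genericDyadic β n k p q * f) = 0 := by
    intro f
    set M : CMat β k k ℂ := Matrix.of fun p q => fischer E (genericDyadic β n k p q * f) with hM
    have hM0 : M = 0 := by
      refine eq_zero_of_conj_apply_eq_zero hk (fun h => ?_) fun hβ p q => ?_
      · set T := rightMulMatrix n h
        -- The test polynomial is pre-rotated by Tᵀ, so that rotating by T returns f and acts on u²
        -- only.
        have h2 := fischer_linSubst (rightMulMatrix_mul_transpose h) E
          (uSq β n k hk * linSubst Tᵀ f)
        rw [hu, hinv, map_mul, linSubst_linSubst_transpose (rightMulMatrix_transpose_mul h), uSq,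
          linSubst_genericDyadic] at h2
        rw [← h2]
        simp only [Finset.sum_mul, map_sum, smul_mul_assoc, map_smul, smul_eq_mul]
        rw [Matrix.mul_apply]
        simp only [Matrix.mul_apply, Finset.sum_mul, Matrix.conjTranspose_apply, hM, Matrix.of_apply]
        rw [Finset.sum_comm]
        exact Finset.sum_congr rfl fun p' _ => Finset.sum_congr rfl fun q' _ => by ring
      · simp only [hM, Matrix.of_apply]
        rw [genericDyadic_comm_of_real hβ]
    intro p q
    exact congrFun (congrFun hM0 p) q
  have h2 : ∀ P ∈ dyadicIdeal β n k, ∀ f, fischer E (P * f) = 0 := by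
    intro P hP
    refine Submodule.span_induction ?_ ?_ ?_ ?_ hP
    · rintro _ ⟨⟨p, q⟩, rfl⟩ f
      exact h1 f p q
    · simp
    · intro x y _ _ hx hy f
      rw [add_mul, map_add, hx, hy, add_zero]
    · intro a x _ hx f
      rw [smul_eq_mul, mul_assoc, mul_left_comm, hx]
  refine eq_zero_of_fischer_conj hE ?_
  simpa using h2 _ (map_conj_mem hmem) 1

end Components


/-! ### Even symmetric polynomials -/

section Symmetric

open MvPolynomial

variable {σ : Type} [Fintype σ]

theorem eval_aeval_eq {τ ρ R : Type} [CommRing R] (x : τ → R) (g : ρ → MvPolynomial τ R)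
    (P : MvPolynomial ρ R) : eval x (aeval g P) = eval (fun i => eval x (g i)) P := by
  induction P using MvPolynomial.induction_on with
  | C r => simp
  | add P Q hP hQ => rw [map_add, map_add, map_add, hP, hQ]
  | mul_X P c hP => rw [map_mul, map_mul, map_mul, hP, aeval_X, eval_X]

/-- Flipping the sign of s_j alone multiplies a monomial by (-1)^(b_j), so every exponent is even
and can be halved. -/
theorem exists_eval_eq_eval_sq (p : MvPolynomial σ ℝ)
    (h : ∀ ε : σ → ℝ, (∀ j, ε j ^ 2 = 1) → ∀ s, eval (fun j => s j * ε j) p = eval s p) :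
    ∃ q : MvPolynomial σ ℝ, ∀ s, eval s p = eval (fun j => s j ^ 2) q := by
  classical
  have heven : ∀ b ∈ p.support, ∀ j, Even (b j) := by
    intro b hb j
    set ε : σ → ℝ := Function.update 1 j (-1) with hε
    have hε2 : ∀ i, ε i ^ 2 = 1 := by
      intro i
      by_cases hij : i = j
      · subst hij; simp [hε]
      · simp [hε, hij]
    have hp : p = ∑ c ∈ p.support, monomial c (coeff c p * (-1) ^ c j) := by
      refine funext fun s => ?_
      rw [← h ε hε2 s, eval_eq', map_sum]
      refine Finset.sum_congr rfl fun c _ => ?_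
      rw [eval_monomial, Finsupp.prod_fintype _ _ (by simp)]
      simp_rw [mul_pow, Finset.prod_mul_distrib]
      have : ∏ i, ε i ^ c i = (-1) ^ c j := by
        rw [Finset.prod_eq_single j]
        · simp [hε]
        · intro i _ hi
          simp [hε, hi]
        · simp
      rw [this]
      ring
    have hc := congrArg (coeff b) hp
    rw [coeff_sum, Finset.sum_eq_single b, coeff_monomial, if_pos rfl] at hc
    · by_contra hodd
      rw [Nat.not_even_iff_odd] at hodd
      rw [hodd.neg_one_pow] at hc
      exact mem_support_iff.1 hb (by linarith)
    · intro c _ hcb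
      rw [coeff_monomial, if_neg hcb]
    · exact fun hb' => absurd hb hb'
  refine ⟨∑ b ∈ p.support, monomial (Finsupp.equivFunOnFinite.symm fun j => b j / 2) (coeff b p),
    fun s => ?_⟩
  rw [eval_eq', map_sum]
  refine Finset.sum_congr rfl fun b hb => ?_
  rw [eval_monomial, Finsupp.prod_fintype _ _ (by simp)]
  congr 1
  refine Finset.prod_congr rfl fun j _ => ?_
  simp only [Finsupp.equivFunOnFinite_symm_apply_apply]
  rw [← pow_mul, Nat.two_mul_div_two_of_even (heven b hb j)]

theorem exists_eval_eq_eval_esymm {k : ℕ} (p : MvPolynomial (Fin k) ℝ)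
    (heven : ∀ ε : Fin k → ℝ, (∀ j, ε j ^ 2 = 1) → ∀ s, eval (fun j => s j * ε j) p = eval s p)
    (hsymm : ∀ (e : Equiv.Perm (Fin k)) s, eval (s ∘ e) p = eval s p) :
    ∃ Q : MvPolynomial (Fin k) ℝ, ∀ s, eval s p =
      eval (fun i : Fin k => eval (fun j => s j ^ 2) (esymm (Fin k) ℝ (i + 1))) Q := by
  obtain ⟨q, hq⟩ := exists_eval_eq_eval_sq p heven
  have hqs : q.IsSymmetric := by
    intro e
    refine funext_set (fun _ => Set.range fun s : ℕ => (s : ℝ) ^ 2)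
      (fun _ => Set.infinite_range_of_injective fun a b hab => ?_) fun x hx => ?_
    · have : a ^ 2 = b ^ 2 := by exact_mod_cast hab
      exact Nat.pow_left_injective two_ne_zero this
    · choose s hs using fun j => hx j (Set.mem_univ j)
      obtain rfl : (fun j => (s j : ℝ) ^ 2) = x := _root_.funext hs
      rw [eval_rename, ← hq fun j => (s j : ℝ), ← hsymm e, hq]
      rfl
  obtain ⟨Q, hQ⟩ := (esymmAlgHom_fin_bijective ℝ k).2 ⟨q, hqs⟩
  refine ⟨Q, fun s => ?_⟩
  have hQ' : aeval (fun i : Fin k => esymm (Fin k) ℝ (i + 1)) Q = q := by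
    rw [← esymmAlgHom_apply, hQ]
  rw [hq, ← hQ', eval_aeval_eq]

end Symmetric

/-! ### Construction of Ψ from the moments. -/

section Existence

open Matrix

variable {β : DysonIndex} {n k : ℕ}

/-- The group element given by a real orthogonal matrix. -/
noncomputable def realUnitary (β : DysonIndex) (M : Matrix (Fin k) (Fin k) ℝ) (hM : Mᵀ * M = 1) :
    unitaryGp β k :=
  unitaryGp.mk (realMat β M) (InGl.realMat M)
    (by rw [realMat_conjTranspose, ← realMat_mul, hM, realMat_one])

theorem eval_momentPoly_diagMat_mul (hk : k ≤ n) (d : ℕ) (s ε : Fin k → ℝ)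
    (hε : ∀ j, ε j ^ 2 = 1) :
    MvPolynomial.eval (coords β (diagMat β hk fun j => s j * ε j)) (momentPoly β hk d) =
      MvPolynomial.eval (coords β (diagMat β hk s)) (momentPoly β hk d) := by
  have h1 : (diagonal ε)ᵀ * diagonal ε = 1 := by
    rw [diagonal_transpose, diagonal_mul_diagonal, ← diagonal_one]
    congr 1
    ext j
    rw [← sq, hε]
  rw [← eval_momentPoly_mul_mul hk d (diagMat_inGl hk s) 1 (realUnitary β _ h1)]
  have h2 : (1 : unitaryGp β n).1.1 = 1 := rfl
  have h3 : (realUnitary β _ h1).1.1 = realMat β (diagonal ε) := rfl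
  rw [h2, h3, Matrix.one_mul, diagMat, diagMat, Matrix.mul_assoc, ← realMat_mul,
    diagonal_mul_diagonal]

/-- Permuting the singular values is multiplication by a permutation matrix on the right and by its
extension on the left. -/
theorem eval_momentPoly_diagMat_perm (hk : k ≤ n) (d : ℕ) (s : Fin k → ℝ)
    (e : Equiv.Perm (Fin k)) :
    MvPolynomial.eval (coords β (diagMat β hk (s ∘ e))) (momentPoly β hk d) =
      MvPolynomial.eval (coords β (diagMat β hk s)) (momentPoly β hk d) := by
  set M : Matrix (Fin k) (Fin k) ℝ := Matrix.of fun i j => if e i = j then 1 else 0 with hM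
  have h0 : M * Mᵀ = 1 := by
    ext i j
    simp [hM, Matrix.mul_apply, Matrix.one_apply, eq_comm]
  have h1 : Mᵀ * M = 1 := mul_eq_one_comm.1 h0
  have h1' : Mᵀᵀ * Mᵀ = 1 := by rwa [transpose_transpose]
  have h2 : diagonal (s ∘ e) = M * diagonal s * Mᵀ := by
    ext i j
    rw [Matrix.mul_apply]
    simp only [Matrix.mul_diagonal, hM, Matrix.of_apply, Matrix.transpose_apply, diagonal_apply]
    by_cases hij : i = j <;> simp [hij]
  rw [← eval_momentPoly_mul_mul hk d (diagMat_inGl hk s) (extend hk (realUnitary β _ h1))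
    (realUnitary β _ h1')]
  have h3 : (realUnitary β _ h1).1.1 = realMat β M := rfl
  have h4 : (realUnitary β _ h1').1.1 = realMat β Mᵀ := rfl
  have h5 := extend_mul_incl hk (realUnitary β _ h1)
  rw [h3] at h5
  rw [h4, diagMat, diagMat, ← Matrix.mul_assoc, h5, h2, realMat_mul, realMat_mul]
  simp only [Matrix.mul_assoc]

/-- The rectangular diagonal matrices as a linear family. -/
noncomputable def diagCoordsLM (β : DysonIndex) (hk : k ≤ n) :
    (Fin k → ℝ) →ₗ[ℝ] Coord β n k → ℝ :=
  (coordsLM β n k).comp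
    { toFun := diagMat β hk
      map_add' := fun s t => by
        rw [diagMat, diagMat, diagMat, ← Matrix.mul_add]
        congr 1
        ext p q
        by_cases h : p.1 = q.1 <;> simp [realMat_apply, h, add_mul]
      map_smul' := fun r s => by
        rw [diagMat, diagMat, RingHom.id_apply, ← Matrix.mul_smul]
        congr 1
        ext p q
        by_cases h : p.1 = q.1 <;> simp [realMat_apply, h, mul_assoc] }

theorem exists_eval_diagMat (hk : k ≤ n) (P : MvPolynomial (Coord β n k) ℝ) :
    ∃ p : MvPolynomial (Fin k) ℝ, ∀ s,
      MvPolynomial.eval s p = MvPolynomial.eval (coords β (diagMat β hk s)) P := by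
  refine ⟨MvPolynomial.aeval (fun c => ∑ j,
    MvPolynomial.C (diagCoordsLM β hk (Pi.single j 1) c) * MvPolynomial.X j) P, fun s => ?_⟩
  rw [eval_aeval_eq]
  congr 2
  funext c
  have h1 : diagCoordsLM β hk s = ∑ j, s j • diagCoordsLM β hk (Pi.single j 1) := by
    conv_lhs => rw [pi_eq_sum_univ' s]
    simp [map_sum]
  have h2 : coords β (diagMat β hk s) = diagCoordsLM β hk s := rfl
  rw [h2, h1]
  simp [mul_comm]

theorem eval_ofReal {σ : Type} (y : σ → ℝ) (P : MvPolynomial σ ℝ) :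
    MvPolynomial.eval (fun c => (y c : ℂ)) (P.map Complex.ofRealHom) =
      ((MvPolynomial.eval y P : ℝ) : ℂ) := by
  rw [MvPolynomial.eval_map]
  exact (MvPolynomial.eval₂_comp_left Complex.ofRealHom (RingHom.id ℝ) y P).symm

theorem exists_momentPoly_eq (hk : k ≤ n) (d : ℕ) : ∃ Q : MvPolynomial (Fin k) ℝ,
    (momentPoly β hk d).map Complex.ofRealHom =
      MvPolynomial.aeval (invariantPoly β n k) (Q.map Complex.ofRealHom) := by
  obtain ⟨p, hp⟩ := exists_eval_diagMat hk (momentPoly β hk d)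
  obtain ⟨Q, hQ⟩ := exists_eval_eq_eval_esymm p
    (fun ε hε s => by rw [hp, hp, eval_momentPoly_diagMat_mul hk d s ε hε])
    (fun e s => by rw [hp, hp, eval_momentPoly_diagMat_perm])
  refine ⟨Q, ext_inGl fun B hB => ?_⟩
  obtain ⟨g, h, s, hs⟩ := exists_svd hk B hB
  have h1 : ∀ j, invVal B j = ((MvPolynomial.eval (fun i => s i ^ 2)
      (MvPolynomial.esymm (Fin k) ℝ (j + 1)) : ℝ) : ℂ) := by
    intro j
    rw [← invVal_mul_mul g h B, hs]
    refine (invVal_diagMat hk s j).trans ?_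
    rw [← eval_ofReal, MvPolynomial.map_esymm]
  rw [eval_ofReal, ← eval_momentPoly_mul_mul hk d hB g h, hs]
  have h2 : incl β hk * realMat β (diagonal s) = diagMat β hk s := rfl
  rw [h2, ← hp, hQ, ← eval_ofReal, eval_aeval_eq]
  simp_rw [← h1, eval_coords_invariantPoly hB]

/-- The coefficient of Ψ at a is read off from the polynomial Q_d with d the weight of a. Projecting
Q_d(I) to degree 2d discards any monomials of other weight that Q_d may contain. -/
theorem exists_component_eq (β : DysonIndex) (hk : k ≤ n) : ∃ Ψ : MvPowerSeries (Fin k) ℝ, ∀ d,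
    component β n k Ψ d = (momentPoly β hk d).map Complex.ofRealHom := by
  classical
  choose Q hQ using fun d => exists_momentPoly_eq (β := β) hk d
  obtain ⟨Ψ, hΨ⟩ : ∃ Ψ : MvPowerSeries (Fin k) ℝ, ∀ a, MvPowerSeries.coeff a Ψ =
      (Q (∑ j : Fin k, ((j : ℕ) + 1) * a j)).coeff a := ⟨fun a => _, fun a => rfl⟩
  refine ⟨Ψ, fun d => ?_⟩
  have h1 := (isHomogeneous_momentPoly (β := β) hk d).map Complex.ofRealHom
  have h2 := MvPolynomial.homogeneousComponent_of_mem (m := 2 * d) h1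
  rw [if_pos rfl] at h2
  rw [← h2, hQ d, MvPolynomial.aeval_def, MvPolynomial.eval₂_eq', map_sum]
  have h3 : ∀ a : Fin k →₀ ℕ, MvPolynomial.homogeneousComponent (2 * d)
      (algebraMap ℂ (Poly β n k) (((Q d).map Complex.ofRealHom).coeff a) *
        ∏ j, invariantPoly β n k j ^ a j) =
      if a ∈ multiIndices k d then
        MvPolynomial.C (((Q d).map Complex.ofRealHom).coeff a) * invMonomial β n k a else 0 := by
    intro a
    rw [MvPolynomial.algebraMap_eq, MvPolynomial.homogeneousComponent_C_mul]
    have := MvPolynomial.homogeneousComponent_of_mem (m := 2 * d)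
      (isHomogeneous_invMonomial (β := β) (n := n) a)
    rw [invMonomial] at this
    rw [this, invMonomial, mul_ite, mul_zero]
    exact if_congr (by rw [mem_multiIndices]; omega) rfl rfl
  simp_rw [h3]
  rw [Finset.sum_ite_mem]
  unfold component
  symm
  refine Finset.sum_subset_zero_on_sdiff Finset.inter_subset_right ?_ ?_
  · intro a ha
    have hns : a ∉ ((Q d).map Complex.ofRealHom).support := fun hs =>
      (Finset.mem_sdiff.1 ha).2 (Finset.mem_inter.2 ⟨hs, (Finset.mem_sdiff.1 ha).1⟩)
    rw [MvPolynomial.notMem_support_iff, MvPolynomial.coeff_map] at hns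
    have hw := mem_multiIndices.1 (Finset.mem_sdiff.1 ha).1
    rw [hΨ, hw]
    simp only [Complex.ofRealHom_eq_coe] at hns
    rw [hns]
    simp
  · intro a ha
    rw [MvPolynomial.coeff_map, hΨ, mem_multiIndices.1 (Finset.mem_inter.1 ha).2]
    rfl

/-! ### Uniqueness of the series and the Pizzetti formula. -/

/-- Only u ≥ 0 is assumed because u arises as the square of a real scaling factor. Once c vanishes
below N, divide by u^N and let u = 1/(m+1) tend to 0; summability at u = 1 provides the dominating
series. -/
theorem powerSeries_eq_zero {c : ℕ → ℂ}
    (h : ∀ u : ℝ, 0 ≤ u → HasSum (fun d => (u : ℂ) ^ d * c d) 0) : c = 0 := by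
  funext N
  induction N using Nat.strong_induction_on with
  | _ N ih =>
    have hs : Summable fun d => ‖c (d + N)‖ := by
      have := (h 1 zero_le_one).summable.norm
      simp only [Complex.ofReal_one, one_pow, one_mul] at this
      exact (summable_nat_add_iff N).2 this
    have h0 : ∀ m : ℕ, ∑' d, ((1 / ((m : ℝ) + 1) : ℝ) : ℂ) ^ d * c (d + N) = 0 := by
      intro m
      set u : ℝ := 1 / ((m : ℝ) + 1) with hu
      have hu0 : (u : ℂ) ≠ 0 := Complex.ofReal_ne_zero.2 (by positivity)
      have h1 := (hasSum_nat_add_iff' N).2 (h u (by positivity))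
      rw [Finset.sum_eq_zero (fun i hi => by
        rw [ih i (Finset.mem_range.1 hi)]; simp), sub_zero] at h1
      have h2 := h1.mul_left (((u : ℂ) ^ N)⁻¹)
      rw [mul_zero] at h2
      rw [← h2.tsum_eq]
      refine tsum_congr fun d => ?_
      rw [pow_add]
      field_simp
    have ht := tendsto_tsum_of_dominated_convergence (𝓕 := Filter.atTop)
      (f := fun (m : ℕ) d => ((1 / ((m : ℝ) + 1) : ℝ) : ℂ) ^ d * c (d + N))
      (g := fun d => (0 : ℂ) ^ d * c (d + N)) hs
      (fun d => by
        refine Filter.Tendsto.mul_const _ (Filter.Tendsto.pow ?_ d)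
        have := (Complex.continuous_ofReal.tendsto 0).comp
          (tendsto_one_div_add_atTop_nhds_zero_nat (𝕜 := ℝ))
        simpa [Function.comp_def] using this)
      (Filter.Eventually.of_forall fun m d => by
        rw [norm_mul, norm_pow]
        refine mul_le_of_le_one_left (norm_nonneg _) (pow_le_one₀ (norm_nonneg _) ?_)
        rw [Complex.norm_real, Real.norm_of_nonneg (by positivity)]
        exact (div_le_one (by positivity)).2 (by linarith [(Nat.cast_nonneg m : (0 : ℝ) ≤ m)]))
    simp_rw [h0] at ht
    have h1 := tendsto_nhds_unique ht tendsto_const_nhds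
    rw [tsum_eq_single 0 (fun d hd => by rw [zero_pow hd, zero_mul])] at h1
    simpa using h1

theorem isPizzettiSeries_of_component (hk : k ≤ n) {Ψ : MvPowerSeries (Fin k) ℝ}
    (hΨ : ∀ d, component β n k Ψ d = (momentPoly β hk d).map Complex.ofRealHom) :
    IsPizzettiSeries β hk Ψ := by
  intro B hB
  have := hasSum_psiHat hk hB
  simp_rw [← eval_ofReal, ← hΨ, eval_component hB] at this
  simpa only [eval_coords_invariantPoly hB] using this

/-- Replacing B by √u B turns the sum over degrees into a convergent power series in u, whose
coefficients are determined. -/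
theorem eq_of_isPizzettiSeries (hk : k ≤ n) {φ ψ : MvPowerSeries (Fin k) ℝ}
    (hφ : IsPizzettiSeries β hk φ) (hψ : IsPizzettiSeries β hk ψ) : φ = ψ := by
  have hev : ∀ {φ : MvPowerSeries (Fin k) ℝ}, IsPizzettiSeries β hk φ → ∀ B : CMat β n k ℂ,
      InGl β B → HasSum (fun d => MvPolynomial.eval (fun c => (coords β B c : ℂ))
        (component β n k φ d)) (psiHat β hk B) := by
    intro φ h B hB
    simp_rw [eval_component hB]
    simpa only [eval_coords_invariantPoly hB] using h B hB
  refine eq_of_component_eq (β := β) hk fun d => ext_inGl fun B hB => ?_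
  rw [← sub_eq_zero]
  refine congrFun (powerSeries_eq_zero (c := fun d =>
    MvPolynomial.eval (fun c => (coords β B c : ℂ)) (component β n k φ d) -
      MvPolynomial.eval (fun c => (coords β B c : ℂ)) (component β n k ψ d)) fun u hu => ?_) d
  have h1 := (hev hφ _ (hB.real_smul (Real.sqrt u))).sub (hev hψ _ (hB.real_smul (Real.sqrt u)))
  simp_rw [eval_component_smul hB, Real.sq_sqrt hu, ← mul_sub, sub_self] at h1
  exact h1

theorem stiefelIntegral_eval_add (hk : k ≤ n) (f g : Poly β n k) :
    stiefelIntegral β hk (fun A => MvPolynomial.eval (fun c => (coords β A c : ℂ)) (f + g)) =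
      stiefelIntegral β hk (fun A => MvPolynomial.eval (fun c => (coords β A c : ℂ)) f) +
      stiefelIntegral β hk (fun A => MvPolynomial.eval (fun c => (coords β A c : ℂ)) g) := by
  have hc : ∀ f : Poly β n k, Continuous fun U : unitaryGp β n =>
      MvPolynomial.eval (fun c => (coords β (firstCols β hk U) c : ℂ)) f := fun f =>
    (MvPolynomial.continuous_eval f).comp (continuous_pi fun c =>
      Complex.continuous_ofReal.comp (continuous_coords_firstCols hk c))
  simp only [stiefelIntegral, map_add]
  exact MeasureTheory.integral_add (integrable_of_continuous (hc f)) (integrable_of_continuous (hc g))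

theorem stiefelIntegral_eq_applySeries (hk : k ≤ n) {Ψ : MvPowerSeries (Fin k) ℝ}
    (hΨ : ∀ d, component β n k Ψ d = (momentPoly β hk d).map Complex.ofRealHom) (f : Poly β n k) :
    stiefelIntegral β hk (fun A => MvPolynomial.eval (fun c => (coords β A c : ℂ)) f) =
      applySeries β n k Ψ f := by
  induction f using MvPolynomial.induction_on' with
  | monomial b r =>
    have h := MvPolynomial.isHomogeneous_monomial (n := b.degree) r rfl
    rcases Nat.even_or_odd b.degree with ⟨d, hd⟩ | hodd
    · rw [hd, ← two_mul] at h
      rw [applySeries_of_even Ψ h, hΨ, fischer_momentPoly hk h]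
    · rw [applySeries_of_odd Ψ hodd h, integral_eval_of_odd hk hodd h]
  | add f g hf hg => rw [stiefelIntegral_eval_add, applySeries_add, hf, hg]

theorem eval_uSq (hk : k ≤ n) (hk0 : 0 < k) (U : unitaryGp β n) :
    MvPolynomial.eval (fun c => (coords β (firstCols β hk U) c : ℂ)) (uSq β n k hk0) = 1 := by
  have := congrFun (congrFun (genericDyadic_map_eval (coords β (firstCols β hk U)))
    (⟨0, hk0⟩, ⟨0, gam_pos β⟩)) (⟨0, hk0⟩, ⟨0, gam_pos β⟩)
  rw [toMat_coords (firstCols_inGl hk U), firstCols_conjTranspose_mul, Matrix.one_apply_eq] at this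
  exact this

theorem applySeries_one (φ : MvPowerSeries (Fin k) ℝ) :
    applySeries β n k φ 1 = ((MvPowerSeries.constantCoeff φ : ℝ) : ℂ) := by
  rw [applySeries_of_even (d := 0) φ (MvPolynomial.isHomogeneous_one _ _), component_zero,
    fischer_apply, ← MvPolynomial.algebraMap_eq, AlgHom.commutes]
  simp

/-- The condition is a recursion: u² f of degree 2(d+1) sees the component d+1, whereas f of degree
2d sees the component d. The constant term starts it. -/
theorem component_eq_of_uSq (hk0 : 0 < k) {φ ψ : MvPowerSeries (Fin k) ℝ}
    (hc : MvPowerSeries.constantCoeff φ = MvPowerSeries.constantCoeff ψ)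
    (hφ : ∀ f, applySeries β n k φ (uSq β n k hk0 * f) = applySeries β n k φ f)
    (hψ : ∀ f, applySeries β n k ψ (uSq β n k hk0 * f) = applySeries β n k ψ f) (d : ℕ) :
    component β n k φ d = component β n k ψ d := by
  induction d with
  | zero => rw [component_zero, component_zero, hc]
  | succ d ih =>
    have hE := (isHomogeneous_component (β := β) (n := n) φ (d + 1)).sub
      (isHomogeneous_component ψ (d + 1))
    rw [← sub_eq_zero]
    refine eq_zero_of_fischer_uSq hk0 hE
      (Ideal.sub_mem _ (component_succ_mem φ d) (component_succ_mem ψ d))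
      (fun h => by rw [map_sub, linSubst_component, linSubst_component]) fun f => ?_
    rw [f.as_sum, Finset.mul_sum, map_sum]
    refine Finset.sum_eq_zero fun b _ => ?_
    have hb := MvPolynomial.isHomogeneous_monomial (n := b.degree) (f.coeff b) rfl
    have hub : (uSq β n k hk0 * MvPolynomial.monomial b (f.coeff b)).IsHomogeneous
        (2 + b.degree) := (isHomogeneous_genericDyadic _ _).mul hb
    by_cases hd : b.degree = 2 * d
    · rw [hd] at hb hub
      rw [show 2 + 2 * d = 2 * (d + 1) by ring] at hub
      rw [map_sub, LinearMap.sub_apply, ← applySeries_of_even φ hub, ← applySeries_of_even ψ hub,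
        hφ, hψ, applySeries_of_even φ hb, applySeries_of_even ψ hb, ih, sub_self]
    · exact fischer_of_isHomogeneous hE hub (by omega)

end Existence

end Pizzetti

theorem proposition4p3 (β : DysonIndex) (n m : ℕ) (hm : m < n) :
    ∃ Ψ : MvPowerSeries (Fin (n - m)) ℝ,
      (∀ ψ : MvPowerSeries (Fin (n - m)) ℝ,
        Pizzetti.IsPizzettiSeries β (Nat.sub_le n m) ψ ↔ ψ = Ψ) ∧
      (∀ φ : MvPowerSeries (Fin (n - m)) ℝ,
        (MvPowerSeries.constantCoeff φ = 1 ∧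
          ∀ f : Pizzetti.Poly β n (n - m),
            Pizzetti.applySeries β n (n - m) φ
                (Pizzetti.uSq β n (n - m) (Nat.sub_pos_of_lt hm) * f) =
              Pizzetti.applySeries β n (n - m) φ f) ↔ φ = Ψ) ∧
      (∀ φ : MvPowerSeries (Fin (n - m)) ℝ,
        (∀ f : Pizzetti.Poly β n (n - m),
          Pizzetti.stiefelIntegral β (Nat.sub_le n m)
              (fun A => MvPolynomial.eval (fun c => (Pizzetti.coords β A c : ℂ)) f) =
            Pizzetti.applySeries β n (n - m) φ f) ↔ φ = Ψ) := by
  have hk := Nat.sub_le n m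
  have hk0 := Nat.sub_pos_of_lt hm
  obtain ⟨Ψ, hΨ⟩ := Pizzetti.exists_component_eq β hk
  have hS := Pizzetti.isPizzettiSeries_of_component hk hΨ
  have hP := Pizzetti.stiefelIntegral_eq_applySeries hk hΨ
  -- The Pizzetti formula at f = 1, with total mass one.
  have hc : MvPowerSeries.constantCoeff Ψ = 1 := by
    have h1 := hP 1
    rw [Pizzetti.applySeries_one] at h1
    simp only [Pizzetti.stiefelIntegral, map_one, MeasureTheory.integral_const,
      MeasureTheory.probReal_univ, one_smul] at h1
    exact_mod_cast h1.symm
  -- Both sides are integrals over the Stiefel manifold, where A†A = 1 makes u² equal to 1.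
  have hu : ∀ f : Pizzetti.Poly β n (n - m),
      Pizzetti.applySeries β n (n - m) Ψ (Pizzetti.uSq β n (n - m) hk0 * f) =
        Pizzetti.applySeries β n (n - m) Ψ f := by
    intro f
    rw [← hP, ← hP]
    simp only [Pizzetti.stiefelIntegral, map_mul, Pizzetti.eval_uSq hk hk0, one_mul]
  refine ⟨Ψ, fun ψ => ⟨fun h => Pizzetti.eq_of_isPizzettiSeries hk h hS, ?_⟩,
    fun φ => ⟨fun h => ?_, ?_⟩, fun φ => ⟨fun h => ?_, ?_⟩⟩
  · rintro rfl
    exact hS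
  · exact Pizzetti.eq_of_component_eq (β := β) hk
      (Pizzetti.component_eq_of_uSq hk0 (h.1.trans hc.symm) h.2 hu)
  · rintro rfl
    exact ⟨hc, hu⟩
  · exact Pizzetti.eq_of_component_eq (β := β) hk
      (Pizzetti.component_eq_of_applySeries_eq fun f => (h f).symm.trans (hP f))
  · rintro rfl
    exact hP
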